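/- Consider simple graphs $G$ on the vertex set $V=\{v_1,\dots,v_n\}$, $n\ge 1$, with the neighbors of each vertex listed in an arbitrary but fixed order. A quantum query algorithm (which knows $n$ but not $G$ or its maximum degree $\Delta=\Delta(G)$) works on finitely many registers, may apply arbitrary unitaries that do not depend on $G$, may perform measurements in the computational basis and proceed according to their outcomes, and has access to $G$ only through the following quantum queries: adjacency queries $|v,u\rangle\mapsto(-1)^{A_{v,u}}|v,u\rangle$, where $A$ is the adjacency matrix; neighborhood queries $|v,j,y\rangle\mapsto|v,j,y\oplus f(v,j)\rangle$, where $f(v,j)$ encodes in binary the $j$-th neighbor of $v$, or is $0$ if there is none; and degree queries $|v,y\rangle\mapsto|v,y\oplus d(v)\rangle$. Its cost is the number of queries of all three kinds that it makes. There is a quantum query algorithm for $(\Delta+1)$-coloring that uses $\tilde O(n^{4/3})$ queries in expectation and succeeds with high probability. Precisely: there is $b\in\mathbb N$ such that for every $k\in\mathbb N$ there is a constant $C>0$ such that for every $n\ge1$ there is a quantum query algorithm which, on every graph $G$ with $n$ vertices and every ordering of the neighbors, outputs a proper $(\Delta(G)+1)$-coloring of $G$ with probability at least $1-(n+1)^{-k}$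 and makes at most $C\,n^{4/3}\,(\log(n+1))^{b}$ queries in expectation. -/

import Mathlib

namespace QuantumColoring

/-- An input of the graph query model on the vertex set `Fin n`: a simple graph, together with
an arbitrary but fixed ordering of the neighbors of every vertex. -/
structure Input (n : ℕ) where
  graph : SimpleGraph (Fin n)
  decAdj : DecidableRel graph.Adj
  nbr : ∀ v : Fin n, Fin (graph.degree v) ≃ graph.neighborSet v

attribute [instance] Input.decAdj

/-- The number of bits of an answer register. As `n < 2 ^ Nat.size n`, the numbers `0, …, n`
have pairwise distinct encodings on `Nat.size n` bits. -/
abbrev Answer (n : ℕ) : Type := BitVec (Nat.size n)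

/-- The answer to the neighborhood query `(v, j)`: the `j`-th neighbor `u` of `v` (with `j` counted
from `0`), encoded as the positive number `u + 1`, and `0` if `v` has no `j`-th neighbor. -/
def Input.neighborAnswer {n : ℕ} (I : Input n) (v j : Fin n) : Answer n :=
  if h : (j : ℕ) < I.graph.degree v then
    BitVec.ofNat _ (((I.nbr v ⟨j, h⟩ : Fin n) : ℕ) + 1)
  else 0

/-- The answer to the degree query `v`: the degree of `v` in binary. -/
def Input.degreeAnswer {n : ℕ} (I : Input n) (v : Fin n) : Answer n :=
  BitVec.ofNat _ (I.graph.degree v)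

/-- The computational basis: `(v, j, y, a)` consists of a vertex `v`, a second register `j` holding
a vertex or an index, an answer register `y`, and a workspace register `a` with `w` values. -/
abbrev Register (n w : ℕ) : Type := Fin n × Fin n × Answer n × Fin w

/-- The finite-dimensional Hilbert space spanned by the computational basis. -/
abbrev State (n w : ℕ) : Type := EuclideanSpace ℂ (Register n w)

/-- The three kinds of queries. -/
inductive QueryKind : Type
  | adjacency
  | neighborhood
  | degree

/-- The action of a quantum query on a state. On basis vectors it is
* adjacency: `|v, u, y, a⟩ ↦ (-1) ^ A(v, u) |v, u, y, a⟩`;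
* neighborhood: `|v, j, y, a⟩ ↦ |v, j, y ⊕ f(v, j), a⟩`;
* degree: `|v, j, y, a⟩ ↦ |v, j, y ⊕ d(v), a⟩`.

The last two permute the basis by an involution, so the coordinate of the new state at a basis
element is the coordinate of the old state at the image of that basis element. -/
noncomputable def Input.applyQuery {n w : ℕ} (I : Input n) :
    QueryKind → State n w → State n w
  | .adjacency, ψ => WithLp.toLp 2 fun x =>
      (if I.graph.Adj x.1 x.2.1 then (-1 : ℂ) else 1) * ψ x
  | .neighborhood, ψ => WithLp.toLp 2 fun x =>
      ψ (x.1, x.2.1, x.2.2.1 ^^^ I.neighborAnswer x.1 x.2.1, x.2.2.2)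
  | .degree, ψ => WithLp.toLp 2 fun x =>
      ψ (x.1, x.2.1, x.2.2.1 ^^^ I.degreeAnswer x.1, x.2.2.2)

/-- Programs of a quantum query algorithm for graphs on `n` vertices with workspace size `w`,
which output an assignment of natural numbers to the vertices. A program may apply an arbitrary
unitary that does not depend on the input, make a query, or perform a projective measurement in the
computational basis (the value of `f` is observed) and continue depending on the outcome. -/
inductive Program (n w : ℕ) : Type
  | output (c : Fin n → ℕ)
  | unitary (U : State n w ≃ₗᵢ[ℂ] State n w) (next : Program n w)
  | query (q : QueryKind) (next : Program n w)
  | measure (m : ℕ) (f : Register n w → Fin m) (next : Fin m → Program n w)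

/-- The unnormalized state after the outcome `i` of the measurement of `f`: the orthogonal
projection onto the span of the basis elements `x` with `f x = i`. The squared norm of the result
is the probability of the outcome times the squared norm of `ψ`. -/
noncomputable def collapse {n w m : ℕ} (f : Register n w → Fin m) (i : Fin m) (ψ : State n w) :
    State n w :=
  WithLp.toLp 2 fun x => if f x = i then ψ x else 0

open Classical in
/-- The probability that the program, run on the input `I` from the state `ψ`, produces an output
in the set `E`. States are not renormalized after a measurement: the squared norm of the current
state is the probability of the branch that has been followed. -/
noncomputable def Program.prob {n w : ℕ} (I : Input n) (E : Set (Fin n → ℕ)) :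
    Program n w → State n w → ℝ
  | .output c, ψ => if c ∈ E then ‖ψ‖ ^ 2 else 0
  | .unitary U next, ψ => next.prob I E (U ψ)
  | .query q next, ψ => next.prob I E (I.applyQuery q ψ)
  | .measure _ f next, ψ => ∑ i, (next i).prob I E (collapse f i ψ)

/-- The expected number of queries that the program makes on the input `I` from the state `ψ`:
every query counts with the probability of the branch in which it is made. -/
noncomputable def Program.expectedQueries {n w : ℕ} (I : Input n) :
    Program n w → State n w → ℝ
  | .output _, _ => 0
  | .unitary U next, ψ => next.expectedQueries I (U ψ)
  | .query q next, ψ => ‖ψ‖ ^ 2 + next.expectedQueries I (I.applyQuery q ψ)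
  | .measure _ f next, ψ => ∑ i, (next i).expectedQueries I (collapse f i ψ)

/-- A quantum query algorithm for graphs on `n` vertices: a workspace size, a basis state in which
it starts, and a program. Nothing but `n` is known about the input, in particular not its maximum
degree. -/
structure Algorithm (n : ℕ) where
  workspace : ℕ
  start : Register n workspace
  program : Program n workspace

/-- The probability that the output of the algorithm on `I` lies in `E`. -/
noncomputable def Algorithm.prob {n : ℕ} (A : Algorithm n) (I : Input n)
    (E : Set (Fin n → ℕ)) : ℝ :=
  A.program.prob I E (EuclideanSpace.single A.start 1)

/-- The expected total number of queries (of all three kinds) of the algorithm on `I`. -/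
noncomputable def Algorithm.expectedQueries {n : ℕ} (A : Algorithm n) (I : Input n) : ℝ :=
  A.program.expectedQueries I (EuclideanSpace.single A.start 1)

/-- The outputs that are proper colorings of the input graph with the colors `0, …, Δ`, where `Δ`
is its maximum degree. -/
def Input.properColorings {n : ℕ} (I : Input n) : Set (Fin n → ℕ) :=
  {c | ∃ χ : I.graph.Coloring (Fin (I.graph.maxDegree + 1)), ∀ v, c v = (χ v : ℕ)}

end QuantumColoring

namespace QuantumColoring

open Finset

/-! ### Linearity of the semantics of programs -/

section Semantics

variable {n w : ℕ} (I : Input n)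

/-! The `n` degree queries reveal Δ. If Δ³ ≤ n, reading all neighbor lists costs nΔ ≤ n^(4/3) and
the coloring needs no further query. Otherwise the vertices are colored greedily in random order.
Each vertex tries the colors 0, …, Δ in random order and keeps the first one for which quantum
search finds no neighbor in the color class.

Cost: one search takes about the square root of the class size. By Cauchy–Schwarz, searching all
classes for one vertex costs O(√(Δn)) up to the number of repetitions (`sum_rounds_le`). If `a`
colors are available, random order reduces this by the factor 1/a (`cost_pick_le`). A vertex of
degree d with r uncolored neighbors has a ≥ Δ + 1 − d + r. In a random order r is uniform on 0, …,
d, so the expectation of 1/a is O(log n / Δ); `sum_potential_erase` carries out this average as an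
exact recursion. Summing over the vertices gives n · √(n/Δ) up to logarithms, which is at most
n^(4/3) when Δ > n^(1/3).

Error: search errs only by missing a neighbor. A run with a random number of iterations misses with
probability at most 3/4 (`sum_missProb_le`), so R repetitions and at most n² tests fail with
probability at most n²(3/4)^R. The cost bound needs no correct tests, because a miss only ends the
trial of colors early.

Every quantum subroutine starts from a known basis state and ends with a full measurement. Programs
therefore reduce to the classical randomized procedures `Proc`, whose expectations compose
(`expect_bind`, `cost_bind`). -/

theorem Input.applyQuery_smul (q : QueryKind) (r : ℂ) (ψ : State n w) :
    I.applyQuery q (r • ψ) = r • I.applyQuery q ψ := by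
  cases q <;> ext x <;> simp [Input.applyQuery]


theorem Input.applyQuery_add (q : QueryKind) (φ ψ : State n w) :
    I.applyQuery q (φ + ψ) = I.applyQuery q φ + I.applyQuery q ψ := by
  cases q <;> ext x <;> simp [Input.applyQuery, mul_add]

theorem Input.norm_applyQuery (q : QueryKind) (ψ : State n w) :
    ‖I.applyQuery q ψ‖ = ‖ψ‖ := by
  rw [EuclideanSpace.norm_eq, EuclideanSpace.norm_eq]
  congr 1
  cases q with
  | adjacency =>
    refine Finset.sum_congr rfl fun x _ => ?_
    simp only [Input.applyQuery]
    split_ifs <;> simp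
  | neighborhood =>
    have h : Function.Involutive (fun x : Register n w =>
        ((x.1, x.2.1, x.2.2.1 ^^^ I.neighborAnswer x.1 x.2.1, x.2.2.2) : Register n w)) := by
      intro x; simp
    exact Equiv.sum_comp h.toPerm fun x => ‖ψ x‖ ^ 2
  | degree =>
    have h : Function.Involutive (fun x : Register n w =>
        ((x.1, x.2.1, x.2.2.1 ^^^ I.degreeAnswer x.1, x.2.2.2) : Register n w)) := by
      intro x; simp
    exact Equiv.sum_comp h.toPerm fun x => ‖ψ x‖ ^ 2

theorem collapse_smul {m : ℕ} (f : Register n w → Fin m) (i : Fin m) (r : ℂ) (ψ : State n w) :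
    collapse f i (r • ψ) = r • collapse f i ψ := by
  ext x; simp [collapse]

/-- States are not renormalized, so after a full measurement the branch state is an amplitude times
a basis vector. Quadratic scaling turns that amplitude into the probability of the branch. -/
theorem Program.prob_smul (E : Set (Fin n → ℕ)) (p : Program n w) (r : ℂ) (ψ : State n w) :
    p.prob I E (r • ψ) = ‖r‖ ^ 2 * p.prob I E ψ := by
  induction p generalizing ψ with
  | output c => simp [Program.prob, norm_smul, mul_pow]
  | unitary U next ih => simp [Program.prob, ih]
  | query q next ih => simp [Program.prob, ih, Input.applyQuery_smul]
  | measure m f next ih => simp [Program.prob, ih, collapse_smul, mul_sum]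

theorem Program.expectedQueries_smul (p : Program n w) (r : ℂ) (ψ : State n w) :
    p.expectedQueries I (r • ψ) = ‖r‖ ^ 2 * p.expectedQueries I ψ := by
  induction p generalizing ψ with
  | output c => simp [Program.expectedQueries]
  | unitary U next ih => simp [Program.expectedQueries, ih]
  | query q next ih =>
    simp [Program.expectedQueries, ih, Input.applyQuery_smul, norm_smul, mul_pow, mul_add]
  | measure m f next ih => simp [Program.expectedQueries, ih, collapse_smul, mul_sum]

/-- A basis vector. -/
noncomputable abbrev ket (x : Register n w) : State n w := EuclideanSpace.single x 1

theorem collapse_injective {m : ℕ} (e : Register n w ≃ Fin m) (x : Register n w)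
    (ψ : State n w) : collapse e (e x) ψ = ψ x • ket x := by
  ext y
  by_cases h : y = x <;> simp [collapse, h]

/-- Measure all registers, and continue depending on the basis element that is observed. -/
noncomputable def Program.measureAll (next : Register n w → Program n w) : Program n w :=
  .measure _ (Fintype.equivFin (Register n w)) fun i => next ((Fintype.equivFin _).symm i)

theorem Program.prob_measureAll (E : Set (Fin n → ℕ)) (next : Register n w → Program n w)
    (ψ : State n w) :
    (Program.measureAll next).prob I E ψ = ∑ x, ‖ψ x‖ ^ 2 * (next x).prob I E (ket x) := by
  rw [Program.measureAll, Program.prob, ← Equiv.sum_comp (Fintype.equivFin (Register n w))]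
  simp [collapse_injective, Program.prob_smul]

theorem Program.expectedQueries_measureAll (next : Register n w → Program n w)
    (ψ : State n w) :
    (Program.measureAll next).expectedQueries I ψ =
      ∑ x, ‖ψ x‖ ^ 2 * (next x).expectedQueries I (ket x) := by
  rw [Program.measureAll, Program.expectedQueries,
    ← Equiv.sum_comp (Fintype.equivFin (Register n w))]
  simp [collapse_injective, Program.expectedQueries_smul]

/-- A sequence of queries, each followed by a unitary. -/
def Program.steps : List (QueryKind × (State n w ≃ₗᵢ[ℂ] State n w)) → Program n w → Program n w
  | [], p => p
  | s :: l, p => .query s.1 (.unitary s.2 (Program.steps l p))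

/-- The state after a sequence of queries, each followed by a unitary. -/
noncomputable def Input.evolve :
    List (QueryKind × (State n w ≃ₗᵢ[ℂ] State n w)) → State n w → State n w
  | [], ψ => ψ
  | s :: l, ψ => Input.evolve l (s.2 (I.applyQuery s.1 ψ))

theorem Input.norm_evolve (l : List (QueryKind × (State n w ≃ₗᵢ[ℂ] State n w)))
    (ψ : State n w) : ‖I.evolve l ψ‖ = ‖ψ‖ := by
  induction l generalizing ψ with
  | nil => rfl
  | cons s l ih => simp [Input.evolve, ih, Input.norm_applyQuery]

theorem Program.prob_steps (E : Set (Fin n → ℕ))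
    (l : List (QueryKind × (State n w ≃ₗᵢ[ℂ] State n w))) (p : Program n w) (ψ : State n w) :
    (Program.steps l p).prob I E ψ = p.prob I E (I.evolve l ψ) := by
  induction l generalizing ψ with
  | nil => rfl
  | cons s l ih => simp [Program.steps, Program.prob, Input.evolve, ih]

theorem Program.expectedQueries_steps
    (l : List (QueryKind × (State n w ≃ₗᵢ[ℂ] State n w))) (p : Program n w) (ψ : State n w) :
    (Program.steps l p).expectedQueries I ψ =
      l.length * ‖ψ‖ ^ 2 + p.expectedQueries I (I.evolve l ψ) := by
  induction l generalizing ψ with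
  | nil => simp [Program.steps, Input.evolve]
  | cons s l ih =>
    simp [Program.steps, Program.expectedQueries, Input.evolve, ih, Input.norm_applyQuery]
    ring

/-- A single unit vector extends to an orthonormal basis indexed by the registers, with `φ` at
position `x`. This lets the next subroutine start afresh from whatever basis state was observed. -/
theorem exists_unitary_ket (x : Register n w) (φ : State n w) (hφ : ‖φ‖ = 1) :
    ∃ U : State n w ≃ₗᵢ[ℂ] State n w, U (ket x) = φ := by
  obtain ⟨b, hb⟩ := Orthonormal.exists_orthonormalBasis_extension_of_card_eq (𝕜 := ℂ)
    (E := State n w) (ι := Register n w) (finrank_euclideanSpace) (v := fun _ => φ)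
    (s := {x}) ⟨fun _ => hφ, fun i j hij => (hij (Subsingleton.elim i j)).elim⟩
  refine ⟨b.repr.symm, ?_⟩
  rw [ket, OrthonormalBasis.repr_symm_single, hb x rfl]

/-- A unitary that takes the basis vector of `x` to the unit vector `φ`. -/
noncomputable def prepare (x : Register n w) (φ : {φ : State n w // ‖φ‖ = 1}) :
    State n w ≃ₗᵢ[ℂ] State n w :=
  (exists_unitary_ket x φ.1 φ.2).choose

theorem prepare_ket (x : Register n w) (φ : {φ : State n w // ‖φ‖ = 1}) :
    prepare x φ (ket x) = φ.1 :=
  (exists_unitary_ket x φ.1 φ.2).choose_spec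

end Semantics

/-! ### Procedures: programs that always return to a basis state -/

/-- A randomized procedure with a result in `α`. In `ask φ l W next` the state `φ` is prepared, the
queries and unitaries of `l` and then `W` are applied, all registers are measured, and the
procedure continues depending on the outcome. -/
inductive Proc (n : ℕ) (α : Type) : Type
  | pure (a : α)
  | ask (φ : {φ : State n n // ‖φ‖ = 1})
      (l : List (QueryKind × (State n n ≃ₗᵢ[ℂ] State n n))) (W : State n n ≃ₗᵢ[ℂ] State n n)
      (next : Register n n → Proc n α)

namespace Proc

variable {n : ℕ} {α β : Type} (I : Input n)

/-- The probability to observe `x`. -/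
noncomputable def weight (φ : State n n) (l : List (QueryKind × (State n n ≃ₗᵢ[ℂ] State n n)))
    (W : State n n ≃ₗᵢ[ℂ] State n n) (x : Register n n) : ℝ :=
  ‖W (I.evolve l φ) x‖ ^ 2

theorem weight_nonneg (φ : State n n) (l : List (QueryKind × (State n n ≃ₗᵢ[ℂ] State n n)))
    (W : State n n ≃ₗᵢ[ℂ] State n n) (x : Register n n) : 0 ≤ weight I φ l W x := by
  unfold weight; positivity

theorem sum_weight (φ : {φ : State n n // ‖φ‖ = 1})
    (l : List (QueryKind × (State n n ≃ₗᵢ[ℂ] State n n)))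
    (W : State n n ≃ₗᵢ[ℂ] State n n) : ∑ x, weight I φ.1 l W x = 1 := by
  simp only [weight]
  rw [← EuclideanSpace.norm_sq_eq]
  simp [Input.norm_evolve, φ.2]

/-- The expectation of a function of the result. -/
noncomputable def expect : Proc n α → (α → ℝ) → ℝ
  | pure a, f => f a
  | ask φ l W next, f => ∑ x, weight I φ.1 l W x * (next x).expect f

/-- The expected number of queries. -/
noncomputable def cost : Proc n α → ℝ
  | pure _ => 0
  | ask φ l W next => l.length + ∑ x, weight I φ.1 l W x * (next x).cost

/-- Sequential composition. -/
def bind : Proc n α → (α → Proc n β) → Proc n β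
  | pure a, k => k a
  | ask φ l W next, k => ask φ l W fun x => (next x).bind k

/-- The program that carries out a procedure from a given basis state. -/
noncomputable def compile : Proc n (Fin n → ℕ) → Register n n → Program n n
  | pure c, _ => .output c
  | ask φ l W next, x =>
      .unitary (prepare x φ) (.steps l (.unitary W (.measureAll fun y => (next y).compile y)))

open Classical in
theorem prob_compile (E : Set (Fin n → ℕ)) (p : Proc n (Fin n → ℕ)) (x : Register n n) :
    (p.compile x).prob I E (ket x) = p.expect I fun c => if c ∈ E then 1 else 0 := by
  induction p generalizing x with
  | pure c => simp [compile, Program.prob, expect]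
  | ask φ l W next ih =>
    simp [compile, Program.prob, expect, Program.prob_steps, Program.prob_measureAll, ih,
      prepare_ket, weight]

theorem expectedQueries_compile (p : Proc n (Fin n → ℕ)) (x : Register n n) :
    (p.compile x).expectedQueries I (ket x) = p.cost I := by
  induction p generalizing x with
  | pure c => simp [compile, Program.expectedQueries, cost]
  | ask φ l W next ih =>
    simp [compile, Program.expectedQueries, cost, Program.expectedQueries_steps,
      Program.expectedQueries_measureAll, ih, prepare_ket, weight, φ.2]

theorem expect_bind (p : Proc n α) (k : α → Proc n β) (f : β → ℝ) :
    (p.bind k).expect I f = p.expect I fun a => (k a).expect I f := by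
  induction p with
  | pure a => rfl
  | ask φ l W next ih => simp [bind, expect, ih]

theorem cost_bind (p : Proc n α) (k : α → Proc n β) :
    (p.bind k).cost I = p.cost I + p.expect I fun a => (k a).cost I := by
  induction p with
  | pure a => simp [bind, cost, expect]
  | ask φ l W next ih => simp [bind, expect, cost, ih, mul_add, sum_add_distrib, add_assoc]

theorem expect_mono (p : Proc n α) {f g : α → ℝ} (h : ∀ a, f a ≤ g a) :
    p.expect I f ≤ p.expect I g := by
  induction p with
  | pure a => exact h a
  | ask φ l W next ih =>
    exact sum_le_sum fun x _ => mul_le_mul_of_nonneg_left (ih x) (weight_nonneg I _ _ _ _)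

theorem expect_const (p : Proc n α) (r : ℝ) : (p.expect I fun _ => r) = r := by
  induction p with
  | pure a => rfl
  | ask φ l W next ih => simp [expect, ih, ← sum_mul, sum_weight]

theorem expect_add (p : Proc n α) (f g : α → ℝ) :
    (p.expect I fun a => f a + g a) = p.expect I f + p.expect I g := by
  induction p with
  | pure a => rfl
  | ask φ l W next ih => simp [expect, ih, mul_add, sum_add_distrib]

theorem expect_mul (p : Proc n α) (r : ℝ) (f : α → ℝ) :
    (p.expect I fun a => r * f a) = r * p.expect I f := by
  induction p with
  | pure a => rfl
  | ask φ l W next ih =>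
    simp only [expect, ih, mul_sum]
    exact sum_congr rfl fun x _ => by ring

theorem cost_nonneg (p : Proc n α) : 0 ≤ p.cost I := by
  induction p with
  | pure a => exact le_rfl
  | ask φ l W next ih =>
    exact add_nonneg (Nat.cast_nonneg _)
      (sum_nonneg fun x _ => mul_nonneg (weight_nonneg I _ _ _ _) (ih x))

end Proc

/-! ### Elementary procedures -/

section Elementary

variable {n : ℕ} [NeZero n] (I : Input n)

/-- The basis elements `(v, i, 0, 0)`. -/
def embReg (v : Fin n) : Fin n ↪ Register n n :=
  ⟨fun i => (v, i, 0, 0), fun i j h => by simpa using h⟩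

theorem embReg_apply (v i : Fin n) : embReg v i = (v, i, 0, 0) := rfl

/-- The uniform superposition over the basis elements in `S`. -/
noncomputable def uniformState {w : ℕ} (S : Finset (Register n w)) : State n w :=
  WithLp.toLp 2 fun x => if x ∈ S then ((1 / √(#S : ℝ) : ℝ) : ℂ) else 0

omit [NeZero n] in
theorem norm_uniformState {w : ℕ} {S : Finset (Register n w)} (hS : S.Nonempty) :
    ‖uniformState S‖ = 1 := by
  have hpos : (0 : ℝ) < #S := by exact_mod_cast hS.card_pos
  rw [← sq_eq_sq₀ (norm_nonneg _) zero_le_one, EuclideanSpace.norm_sq_eq]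
  have : ∀ x, ‖uniformState S x‖ ^ 2 = if x ∈ S then (1 / #S : ℝ) else 0 := by
    intro x
    simp only [uniformState]
    split_ifs
    · rw [Complex.norm_real, Real.norm_eq_abs, sq_abs, div_pow, Real.sq_sqrt hpos.le, one_pow]
    · simp
  simp only [this, sum_ite_mem, univ_inter, sum_const, nsmul_eq_mul]
  field_simp

theorem map_embReg_nonempty (v : Fin n) {s : Finset (Fin n)} (hs : s.Nonempty) :
    (s.map (embReg v)).Nonempty := hs.map

namespace Proc

/-- Draw a uniformly random element of a nonempty set. -/
noncomputable def draw (s : Finset (Fin n)) : Proc n (Fin n) :=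
  if h : s.Nonempty then
    .ask ⟨_, norm_uniformState (map_embReg_nonempty 0 h)⟩ [] (LinearIsometryEquiv.refl ℂ _)
      fun x => .pure x.2.1
  else .pure 0

theorem expect_draw {s : Finset (Fin n)} (hs : s.Nonempty) (f : Fin n → ℝ) :
    (draw s).expect I f = (∑ i ∈ s, f i) / #s := by
  have hpos : (0 : ℝ) < #s := by exact_mod_cast hs.card_pos
  rw [draw, dif_pos hs]
  have : ∀ x : Register n n, weight I (uniformState (s.map (embReg 0))) []
      (LinearIsometryEquiv.refl ℂ _) x * f x.2.1 =
        if x ∈ s.map (embReg 0) then (1 / #s : ℝ) * f x.2.1 else 0 := by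
    intro x
    simp only [weight, Input.evolve, LinearIsometryEquiv.coe_refl, id, uniformState]
    split_ifs
    · rw [Complex.norm_real, Real.norm_eq_abs, sq_abs, div_pow, card_map,
        Real.sq_sqrt hpos.le, one_pow]
    · simp
  simp only [expect, this, sum_ite_mem, univ_inter, sum_map, ← mul_sum]
  simp only [embReg_apply]
  ring

theorem cost_draw (s : Finset (Fin n)) : (draw s).cost I = 0 := by
  unfold draw; split_ifs <;> simp [cost]

/-- Ask for the degree of `v`. -/
noncomputable def degree (v : Fin n) : Proc n ℕ :=
  .ask ⟨ket (v, 0, 0, 0), by simp⟩ [(.degree, LinearIsometryEquiv.refl ℂ _)]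
    (LinearIsometryEquiv.refl ℂ _) fun x => .pure x.2.2.1.toNat

theorem expect_degree (v : Fin n) (f : ℕ → ℝ) :
    (degree v).expect I f = f (I.graph.degree v) := by
  have h : ∀ x : Register n n, weight I (ket (v, 0, 0, 0)) [(.degree, LinearIsometryEquiv.refl ℂ _)]
      (LinearIsometryEquiv.refl ℂ _) x * f x.2.2.1.toNat =
      if x = (v, 0, I.degreeAnswer v, 0) then f x.2.2.1.toNat else 0 := by
    rintro ⟨v', j, y, a⟩
    simp only [weight, Input.evolve, LinearIsometryEquiv.coe_refl, id, Input.applyQuery,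
      PiLp.single_apply, Prod.mk.injEq]
    by_cases hv : v' = v
    · subst hv
      have : y ^^^ I.degreeAnswer v' = 0 ↔ y = I.degreeAnswer v' := BitVec.xor_eq_zero_iff
      simp only [this]
      split_ifs <;> simp
    · simp [hv]
  simp only [degree, expect, h, sum_ite_eq', mem_univ, if_true]
  rw [Input.degreeAnswer, BitVec.toNat_ofNat, Nat.mod_eq_of_lt]
  refine lt_of_lt_of_le ?_ (Nat.lt_size_self n).le
  simpa using I.graph.degree_lt_card_verts v

theorem cost_degree (v : Fin n) : (degree v).cost I = 1 := by
  simp [degree, cost]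

/-- Ask for the `j`-th neighbor of `v`. -/
noncomputable def neighbor (v j : Fin n) : Proc n ℕ :=
  .ask ⟨ket (v, j, 0, 0), by simp⟩ [(.neighborhood, LinearIsometryEquiv.refl ℂ _)]
    (LinearIsometryEquiv.refl ℂ _) fun x => .pure x.2.2.1.toNat

theorem expect_neighbor (v j : Fin n) (f : ℕ → ℝ) :
    (neighbor v j).expect I f = f (I.neighborAnswer v j).toNat := by
  have h : ∀ x : Register n n, weight I (ket (v, j, 0, 0))
      [(.neighborhood, LinearIsometryEquiv.refl ℂ _)]
      (LinearIsometryEquiv.refl ℂ _) x * f x.2.2.1.toNat =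
      if x = (v, j, I.neighborAnswer v j, 0) then f x.2.2.1.toNat else 0 := by
    rintro ⟨v', j', y, a⟩
    simp only [weight, Input.evolve, LinearIsometryEquiv.coe_refl, id, Input.applyQuery,
      PiLp.single_apply, Prod.mk.injEq]
    by_cases hv : v' = v ∧ j' = j
    · obtain ⟨rfl, rfl⟩ := hv
      have : y ^^^ I.neighborAnswer v' j' = 0 ↔ y = I.neighborAnswer v' j' :=
        BitVec.xor_eq_zero_iff
      simp only [this]
      split_ifs <;> simp
    · rw [if_neg (by tauto), if_neg (by tauto)]; simp
  simp only [neighbor, expect, h, sum_ite_eq', mem_univ, if_true]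

theorem cost_neighbor (v j : Fin n) : (neighbor v j).cost I = 1 := by
  simp [neighbor, cost]

/-- Carry out the procedures `q i` for all `i` in a list, and record the results. -/
def collect {ι : Type} [DecidableEq ι] (q : ι → Proc n ℕ) : List ι → (ι → ℕ) → Proc n (ι → ℕ)
  | [], g => .pure g
  | i :: l, g => (q i).bind fun d => collect q l (Function.update g i d)

omit [NeZero n] in
theorem expect_collect {ι : Type} [DecidableEq ι] (q : ι → Proc n ℕ) (d : ι → ℕ)
    (hq : ∀ i f, (q i).expect I f = f (d i)) (l : List ι) (g : ι → ℕ) (f : (ι → ℕ) → ℝ) :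
    (collect q l g).expect I f = f fun i => if i ∈ l then d i else g i := by
  induction l generalizing g with
  | nil => simp [collect, expect]
  | cons i l ih =>
    rw [collect, expect_bind, hq, ih]
    congr 1
    ext j
    by_cases h : j ∈ l <;> by_cases h' : j = i <;> simp [h, h']

omit [NeZero n] in
theorem cost_collect {ι : Type} [DecidableEq ι] (q : ι → Proc n ℕ) (d : ι → ℕ)
    (hq : ∀ i f, (q i).expect I f = f (d i)) (hc : ∀ i, (q i).cost I = 1) (l : List ι)
    (g : ι → ℕ) : (collect q l g).cost I = l.length := by
  induction l generalizing g with
  | nil => simp [collect, cost]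
  | cons i l ih =>
    rw [collect, cost_bind, hq, ih, hc]
    push_cast [List.length_cons]
    ring

end Proc

end Elementary

/-! ### Quantum search -/

section Search

/-- Powers of a product of two reflections, in the plane that they leave invariant. -/
theorem iterate_two_reflections {E : Type*} [NormedAddCommGroup E] [InnerProductSpace ℂ E]
    (Q : E → E) (hadd : ∀ x y, Q (x + y) = Q x + Q y) (hsmul : ∀ (r : ℂ) x, Q (r • x) = r • Q x)
    (hQ : ∀ x, Q (Q x) = x) (u : E) (hu : ‖u‖ = 1) (φ : ℝ)
    (hφ : inner ℂ u (Q u) = (Real.cos φ : ℂ)) (t : ℕ) :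
    (Real.sin φ : ℂ) • ((fun x => (ℂ ∙ u).reflection (Q x))^[t] u) =
      (Real.sin ((t + 1) * φ) : ℂ) • u + (-Real.sin (t * φ) : ℂ) • Q u := by
  -- On the span of `u` and `Q u` the coefficients obey the recursion sin((t+2)φ) = 2 cos φ
  -- sin((t+1)φ) − sin(tφ). The factor sin φ on the left avoids a division.
  have hDu : (ℂ ∙ u).reflection u = u :=
    Submodule.reflection_mem_subspace_eq_self (Submodule.mem_span_singleton_self u)
  have hDQ : (ℂ ∙ u).reflection (Q u) = (2 * Real.cos φ : ℂ) • u - Q u := by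
    rw [Submodule.reflection_singleton_apply, hφ, hu]
    simp [two_smul, two_mul, add_smul]
  induction t with
  | zero => simp
  | succ t ih =>
    rw [Function.iterate_succ_apply', ← map_smul, ← hsmul, ih, hadd, hsmul, hsmul, hQ, map_add,
      map_smul, map_smul, hDu, hDQ, smul_sub, smul_smul, sub_add_eq_add_sub, ← add_smul]
    rw [sub_eq_add_neg, ← neg_smul]
    congr 2
    · have h : Real.sin (((t + 1 : ℕ) + 1) * φ) =
          Real.sin ((t + 1) * φ) * (2 * Real.cos φ) + -Real.sin (t * φ) := by
        have h1 : ((t + 1 : ℕ) + 1) * φ = (t + 1) * φ + φ := by push_cast; ring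
        have h2 : t * φ = (t + 1) * φ - φ := by ring
        rw [h1, h2, Real.sin_add, Real.sin_sub]; ring
      rw [h]; push_cast; ring
    · push_cast; rfl

theorem inner_iterate_two_reflections {E : Type*} [NormedAddCommGroup E] [InnerProductSpace ℂ E]
    (Q : E → E) (hadd : ∀ x y, Q (x + y) = Q x + Q y) (hsmul : ∀ (r : ℂ) x, Q (r • x) = r • Q x)
    (hQ : ∀ x, Q (Q x) = x) (u : E) (hu : ‖u‖ = 1) (φ : ℝ)
    (hφ : inner ℂ u (Q u) = (Real.cos φ : ℂ)) (hsin : Real.sin φ ≠ 0) (t : ℕ) :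
    inner ℂ u ((fun x => (ℂ ∙ u).reflection (Q x))^[t] u) = (Real.cos (t * φ) : ℂ) := by
  have h := congrArg (inner ℂ u) (iterate_two_reflections Q hadd hsmul hQ u hu φ hφ t)
  rw [inner_smul_right, inner_add_right, inner_smul_right, inner_smul_right, hφ,
    inner_self_eq_norm_sq_to_K, hu] at h
  have hs : (Real.sin φ : ℂ) ≠ 0 := by exact_mod_cast hsin
  refine mul_left_cancel₀ hs (h.trans ?_)
  have : Real.sin ((t + 1) * φ) =
      Real.sin φ * Real.cos (t * φ) + Real.sin (t * φ) * Real.cos φ := by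
    rw [add_mul, one_mul, Real.sin_add]; ring
  rw [this]; push_cast; simp

/-- The sum telescopes, since 4 sin φ cos² x = 2 sin φ + sin(2x + φ) − sin(2x − φ). -/
theorem sum_cos_sq (φ : ℝ) (M : ℕ) :
    4 * Real.sin φ * ∑ t ∈ range M, Real.cos ((t + 1 : ℕ) * φ) ^ 2 =
      2 * M * Real.sin φ + Real.sin ((2 * M + 1) * φ) - Real.sin φ := by
  induction M with
  | zero => simp
  | succ M ih =>
    rw [sum_range_succ, mul_add, ih]
    have h1 : (2 * (M + 1 : ℕ) + 1) * φ = 2 * ((M + 1) * φ) + φ := by push_cast; ring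
    have h2 : (2 * M + 1) * φ = 2 * ((M + 1) * φ) - φ := by ring
    rw [h1, h2, Real.sin_add, Real.sin_sub, Real.cos_two_mul]
    push_cast
    ring

/-- The mean of cos² is at most 1/2 + 1/(4M sin φ). A random number of iterations thus works without
knowing φ, that is, without knowing the number of neighbors in the set. -/
theorem sum_cos_sq_le {φ : ℝ} {M : ℕ} (h : 1 ≤ M * Real.sin φ) :
    ∑ t ∈ range M, Real.cos ((t + 1 : ℕ) * φ) ^ 2 ≤ 3 / 4 * M := by
  have hM : (0 : ℝ) ≤ M := M.cast_nonneg
  have hs : 0 < Real.sin φ := by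
    by_contra hs
    nlinarith
  have := sum_cos_sq φ M
  have h1 := Real.sin_le_one ((2 * M + 1) * φ)
  refine le_of_mul_le_mul_left ?_ hs
  nlinarith

variable {n : ℕ} [NeZero n] (I : Input n)

omit [NeZero n] in
theorem Input.evolve_replicate {w : ℕ} (D : State n w ≃ₗᵢ[ℂ] State n w) (q : QueryKind) (t : ℕ)
    (ψ : State n w) :
    I.evolve (List.replicate t (q, D)) ψ = (fun x => D (I.applyQuery q x))^[t] ψ := by
  induction t generalizing ψ with
  | zero => rfl
  | succ t ih => rw [List.replicate_succ, Input.evolve, ih, Function.iterate_succ_apply]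

omit [NeZero n] in
theorem Input.adjacency_involutive {w : ℕ} (ψ : State n w) :
    I.applyQuery .adjacency (I.applyQuery .adjacency ψ) = ψ := by
  ext x
  simp only [Input.applyQuery]
  split_ifs <;> simp

/-- The uniform superposition over the basis elements `(v, i, 0, 0)` with `i ∈ s`. -/
noncomputable def searchState (v : Fin n) (s : Finset (Fin n)) : State n n :=
  uniformState (s.map (embReg v))

theorem adjacency_searchState (v : Fin n) (s : Finset (Fin n))
    (h : ∀ i ∈ s, ¬ I.graph.Adj v i) :
    I.applyQuery .adjacency (searchState v s) = searchState v s := by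
  ext x
  simp only [Input.applyQuery, searchState, uniformState]
  split_ifs with h1 h2
  · obtain ⟨i, hi, rfl⟩ := mem_map.1 h2
    exact absurd h1 (h i hi)
  · simp
  · simp
  · simp

/-- The overlap is the fraction of non-neighbors minus the fraction of neighbors; it is the cosine
of the rotation angle of the search. -/
theorem inner_searchState (v : Fin n) (s : Finset (Fin n)) (hs : s.Nonempty) :
    inner ℂ (searchState v s) (I.applyQuery .adjacency (searchState v s)) =
      ((1 - 2 * #{i ∈ s | I.graph.Adj v i} / #s : ℝ) : ℂ) := by
  have hpos : (0 : ℝ) < #s := by exact_mod_cast hs.card_pos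
  have : ∀ x : Register n n, inner ℂ (searchState v s x)
      (I.applyQuery .adjacency (searchState v s) x) =
      if x ∈ s.map (embReg v) then
        (((if I.graph.Adj x.1 x.2.1 then -1 else 1) * (1 / #s) : ℝ) : ℂ) else 0 := by
    intro x
    simp only [Input.applyQuery, searchState, uniformState, card_map]
    by_cases hx : x ∈ s.map (embReg v)
    · have hsq : (1 / √(#s : ℝ)) * (1 / √(#s : ℝ)) = 1 / #s := by
        rw [div_mul_div_comm, Real.mul_self_sqrt hpos.le, one_mul]
      simp only [hx, if_true, RCLike.inner_apply, Complex.conj_ofReal]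
      rw [mul_assoc, ← Complex.ofReal_mul, hsq]
      split_ifs <;> simp
    · simp [hx]
  rw [PiLp.inner_apply]
  simp only [this, sum_ite_mem, univ_inter, sum_map]
  rw [← Complex.ofReal_sum, ← sum_mul]
  congr 1
  change (∑ i ∈ s, if I.graph.Adj v i then (-1 : ℝ) else 1) * _ = _
  have h2 : ∀ i, (if I.graph.Adj v i then (-1 : ℝ) else 1) =
      1 - 2 * (if I.graph.Adj v i then 1 else 0) := by
    intro i; split_ifs <;> norm_num
  simp only [h2, sum_sub_distrib, ← mul_sum, sum_boole, sum_const, nsmul_eq_mul, mul_one]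
  field_simp

namespace Proc

/-- One run of quantum search with `t` iterations for a neighbor of `v` in `s`. The answer `true`
proves that there is one. -/
noncomputable def search (v : Fin n) (s : Finset (Fin n)) (t : ℕ) : Proc n Bool :=
  .ask ⟨searchState v (insert v s), norm_uniformState (map_embReg_nonempty v (insert_nonempty v s))⟩
    (List.replicate t (.adjacency, (ℂ ∙ searchState v (insert v s)).reflection))
    (prepare (embReg v v) ⟨searchState v (insert v s),
      norm_uniformState (map_embReg_nonempty v (insert_nonempty v s))⟩).symm
    fun x => .pure (decide (x ≠ embReg v v))

/-- The probability that a run of quantum search finds nothing. -/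
noncomputable def missProb (v : Fin n) (s : Finset (Fin n)) (t : ℕ) : ℝ :=
  ‖inner ℂ (searchState v (insert v s)) ((fun x => (ℂ ∙ searchState v (insert v s)).reflection
    (I.applyQuery .adjacency x))^[t] (searchState v (insert v s)))‖ ^ 2

theorem cost_search (v : Fin n) (s : Finset (Fin n)) (t : ℕ) : (search v s t).cost I = t := by
  simp [search, cost]

/-- Undoing the preparation sends the starting state to the basis vector of `embReg v v`, so the
measurement tests whether the state is still the starting state. That basis vector is only a label.
-/
theorem expect_search (v : Fin n) (s : Finset (Fin n)) (t : ℕ) (f : Bool → ℝ) :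
    (search v s t).expect I f =
      missProb I v s t * f false + (1 - missProb I v s t) * f true := by
  have hu : ‖searchState v (insert v s)‖ = 1 :=
    norm_uniformState (map_embReg_nonempty v (insert_nonempty v s))
  set W := (prepare (embReg v v) ⟨searchState v (insert v s), hu⟩) with hW
  have hw : weight I (searchState v (insert v s))
      (List.replicate t (.adjacency, (ℂ ∙ searchState v (insert v s)).reflection)) W.symm
      (embReg v v) = missProb I v s t := by
    rw [weight, missProb, Input.evolve_replicate]
    congr 2
    have h := prepare_ket (embReg v v) ⟨searchState v (insert v s), hu⟩
    conv_rhs => rw [← LinearIsometryEquiv.inner_map_map W.symm]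
    rw [← hW] at h
    have h' : W.symm (searchState v (insert v s)) = ket (embReg v v) := by
      rw [LinearIsometryEquiv.symm_apply_eq]; exact h.symm
    rw [h', ket, EuclideanSpace.inner_single_left]
    simp
  have h1 := sum_weight I ⟨searchState v (insert v s), hu⟩
    (List.replicate t (.adjacency, (ℂ ∙ searchState v (insert v s)).reflection)) W.symm
  rw [← add_sum_erase _ _ (mem_univ (embReg v v)), hw] at h1
  simp only [search, expect]
  rw [← add_sum_erase _ _ (mem_univ (embReg v v)), hw, ← eq_sub_iff_add_eq'.2 h1, sum_mul]
  congr 1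
  · simp
  · refine sum_congr rfl fun x hx => ?_
    simp [(mem_erase.1 hx).1, hW]

/-- Without neighbors in the set both reflections fix the starting state. This is why the error is
one-sided. -/
theorem missProb_eq_one (v : Fin n) (s : Finset (Fin n)) (t : ℕ)
    (h : ∀ i ∈ s, ¬ I.graph.Adj v i) : missProb I v s t = 1 := by
  have hu : ‖searchState v (insert v s)‖ = 1 :=
    norm_uniformState (map_embReg_nonempty v (insert_nonempty v s))
  have hfix : (fun x => (ℂ ∙ searchState v (insert v s)).reflection
      (I.applyQuery .adjacency x)) (searchState v (insert v s)) = searchState v (insert v s) := by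
    simp only
    rw [adjacency_searchState I v _ (by simpa using h)]
    exact Submodule.reflection_mem_subspace_eq_self (Submodule.mem_span_singleton_self _)
  rw [missProb, Function.iterate_fixed hfix, inner_self_eq_norm_sq_to_K, hu]
  simp

/-- A number of iterations that suffices for the search in `s`. -/
def rounds (v : Fin n) (s : Finset (Fin n)) : ℕ := Nat.sqrt (#(insert v s) - 1) + 1

theorem sum_missProb_le (v : Fin n) (s : Finset (Fin n)) (h : ∃ i ∈ s, I.graph.Adj v i) :
    ∑ t ∈ range (rounds v s), missProb I v s (t + 1) ≤ 3 / 4 * rounds v s := by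
  have hu : ‖searchState v (insert v s)‖ = 1 :=
    norm_uniformState (map_embReg_nonempty v (insert_nonempty v s))
  set M := rounds v s with hM
  set N := #(insert v s) with hN
  set k := #{i ∈ insert v s | I.graph.Adj v i} with hk
  have hNpos : 0 < N := (insert_nonempty v s).card_pos
  have hk1 : 1 ≤ k := by
    obtain ⟨i, hi, hvi⟩ := h
    exact card_pos.2 ⟨i, mem_filter.2 ⟨mem_insert_of_mem hi, hvi⟩⟩
  -- The added vertex `v` is not its own neighbor. If all elements were neighbors, the state would
  -- change only by signs and nothing could be detected.
  have hk2 : k + 1 ≤ N := by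
    refine card_lt_card (filter_ssubset.2 ⟨v, mem_insert_self v s, I.graph.loopless.irrefl v⟩)
  have hMN : N ≤ M * M := by
    have h2 := Nat.lt_succ_sqrt (N - 1)
    simp only [hM, rounds, ← hN]
    simp only [Nat.succ_eq_add_one] at h2
    omega
  have hN' : (0 : ℝ) < N := by exact_mod_cast hNpos
  have hk1' : (1 : ℝ) ≤ k := by exact_mod_cast hk1
  have hk2' : (k : ℝ) + 1 ≤ N := by exact_mod_cast hk2
  have hMN' : (N : ℝ) ≤ M * M := by exact_mod_cast hMN
  set γ : ℝ := 1 - 2 * k / N with hγ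
  have hcos : Real.cos (Real.arccos γ) = γ := by
    apply Real.cos_arccos
    · rw [hγ, neg_le_sub_iff_le_add, div_le_iff₀ hN']; linarith
    · rw [hγ, sub_le_self_iff]; positivity
  have hγ2 : 1 - γ ^ 2 = 4 * (k * (N - k)) / N ^ 2 := by
    rw [hγ]; field_simp; ring
  -- Here sin² = 4k(N − k)/N², and k(N − k) ≥ N − 1 for 1 ≤ k ≤ N − 1. Hence sin² ≥ 1/N ≥ 1/M².
  have hsin : 1 ≤ M * Real.sin (Real.arccos γ) := by
    rw [Real.sin_arccos]
    refine (one_le_sq_iff₀ (by positivity)).1 ?_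
    rw [mul_pow, Real.sq_sqrt, hγ2]
    · rw [mul_div_assoc', le_div_iff₀ (by positivity)]
      have : (N : ℝ) - 1 ≤ k * (N - k) := by nlinarith
      have h2N : (2 : ℝ) ≤ N := by linarith
      have h3 : (N : ℝ) ≤ 4 * (k * (N - k)) := by linarith
      have : (N : ℝ) * N ≤ (M * M) * (4 * (k * (N - k))) :=
        mul_le_mul hMN' h3 hN'.le (by positivity)
      nlinarith
    · rw [hγ2]
      have : 0 ≤ (N : ℝ) - k := by linarith
      positivity
  have hs0 : Real.sin (Real.arccos γ) ≠ 0 := by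
    intro h0; rw [h0, mul_zero] at hsin; linarith
  refine le_trans (le_of_eq ?_) (sum_cos_sq_le hsin)
  refine sum_congr rfl fun t _ => ?_
  rw [missProb, inner_iterate_two_reflections _ (I.applyQuery_add _) (I.applyQuery_smul _)
    I.adjacency_involutive _ hu (Real.arccos γ) _ hs0]
  · rw [Complex.norm_real, Real.norm_eq_abs, sq_abs]
  · rw [hcos]; exact inner_searchState I v _ (insert_nonempty v s)

end Proc

end Search

section Greedy

variable {n : ℕ} [NeZero n] (I : Input n)

namespace Proc

/-! ### Testing whether a vertex has a neighbor in a set -/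

theorem missProb_le_one (v : Fin n) (s : Finset (Fin n)) (t : ℕ) : missProb I v s t ≤ 1 := by
  have h := expect_mono I (search v s t) (f := fun _ => 0) (g := fun b => if b then 1 else 0)
    (fun b => by cases b <;> simp)
  rw [expect_const, expect_search] at h
  simp at h
  exact h

omit [NeZero n] in
-- The number of iterations is drawn as an element of `Fin n`, so its range must fit.
theorem rounds_le (v : Fin n) (s : Finset (Fin n)) : rounds v s ≤ n := by
  have h1 : #(insert v s) ≤ n := by simpa using card_le_univ (insert v s)
  have h2 := (insert_nonempty v s).card_pos
  have h3 := Nat.sqrt_le_self (#(insert v s) - 1)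
  unfold rounds
  omega

/-- The numbers below `M`, as elements of `Fin n`. -/
def initial (n M : ℕ) : Finset (Fin n) := {t | (t : ℕ) < M}

omit [NeZero n] in
theorem sum_initial {M : ℕ} (hM : M ≤ n) (f : ℕ → ℝ) :
    ∑ t ∈ initial n M, f t = ∑ t ∈ range M, f t := by
  have h : (initial n M).map Fin.valEmbedding = range M := by
    ext t
    simp only [initial, mem_map, mem_filter, mem_univ, true_and, Fin.valEmbedding_apply, mem_range]
    exact ⟨by rintro ⟨a, ha, rfl⟩; exact ha, fun ht => ⟨⟨t, ht.trans_le hM⟩, ht, rfl⟩⟩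
  rw [← h, sum_map]
  rfl

omit [NeZero n] in
theorem card_initial {M : ℕ} (hM : M ≤ n) : #(initial n M) = M := by
  have := sum_initial hM fun _ => 1
  simp only [sum_const, nsmul_eq_mul, mul_one, card_range] at this
  exact_mod_cast this

omit [NeZero n] in
theorem initial_rounds_nonempty (v : Fin n) (s : Finset (Fin n)) :
    (initial n (rounds v s)).Nonempty := by
  rw [← card_pos, card_initial (rounds_le v s)]
  exact Nat.succ_pos _

/-- Test whether `v` has a neighbor in `s` by repeated quantum search. -/
noncomputable def test (v : Fin n) (s : Finset (Fin n)) : ℕ → Proc n Bool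
  | 0 => .pure false
  | R + 1 => (draw (initial n (rounds v s))).bind fun t =>
      (search v s (t + 1)).bind fun b => if b then .pure true else test v s R

theorem expect_test_of_forall_not_adj (v : Fin n) (s : Finset (Fin n))
    (h : ∀ i ∈ s, ¬ I.graph.Adj v i) (R : ℕ) (f : Bool → ℝ) :
    (test v s R).expect I f = f false := by
  induction R with
  | zero => rfl
  | succ R ih =>
    have hpos : (0 : ℝ) < #(initial n (rounds v s)) := by
      exact_mod_cast (initial_rounds_nonempty v s).card_pos
    rw [test, expect_bind, expect_draw I (initial_rounds_nonempty v s)]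
    simp only [expect_bind, expect_search, missProb_eq_one I v s _ h, if_true, if_false, ih,
      Bool.false_eq_true, one_mul, sub_self, zero_mul, add_zero, sum_const, nsmul_eq_mul]
    field_simp

theorem expect_test_le (v : Fin n) (s : Finset (Fin n)) (h : ∃ i ∈ s, I.graph.Adj v i) (R : ℕ) :
    ((test v s R).expect I fun b => if b then 0 else 1) ≤ (3 / 4 : ℝ) ^ R := by
  induction R with
  | zero => simp [test, expect]
  | succ R ih =>
    have hpos : (0 : ℝ) < rounds v s := by exact_mod_cast Nat.succ_pos _
    rw [test, expect_bind, expect_draw I (initial_rounds_nonempty v s),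
      card_initial (rounds_le v s)]
    simp only [expect_bind, expect_search, if_true, if_false, Bool.false_eq_true]
    simp only [expect, if_true, mul_zero, add_zero, ← sum_mul]
    rw [sum_initial (rounds_le v s) fun t => missProb I v s (t + 1), div_le_iff₀ hpos]
    calc _ ≤ (3 / 4 * rounds v s) * (3 / 4 : ℝ) ^ R := by
          refine mul_le_mul (sum_missProb_le I v s h) ih ?_ (by positivity)
          have := expect_mono I (test v s R) (f := fun _ => 0)
            (g := fun b => if b then 0 else 1) (fun b => by cases b <;> simp)
          rwa [expect_const] at this
      _ = _ := by ring

theorem cost_test_le (v : Fin n) (s : Finset (Fin n)) (R : ℕ) :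
    (test v s R).cost I ≤ R * rounds v s := by
  induction R with
  | zero => simp [test, cost]
  | succ R ih =>
    have hpos : (0 : ℝ) < rounds v s := by exact_mod_cast Nat.succ_pos _
    rw [test, cost_bind, cost_draw, expect_draw I (initial_rounds_nonempty v s),
      card_initial (rounds_le v s), zero_add, div_le_iff₀ hpos]
    have hR : ∀ t ∈ initial n (rounds v s), (((search v s (t + 1)).bind
        fun b => if b then .pure true else test v s R).cost I) ≤
        rounds v s + R * rounds v s := by
      intro t ht
      rw [cost_bind, cost_search, expect_search]
      have ht' : ((t + 1 : ℕ) : ℝ) ≤ rounds v s := by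
        exact_mod_cast (mem_filter.1 ht).2
      simp only [if_true, if_false, Bool.false_eq_true, cost, mul_zero, add_zero]
      refine add_le_add ht' ?_
      exact (mul_le_of_le_one_left (cost_nonneg I _) (missProb_le_one I v s _)).trans ih
    refine (sum_le_card_nsmul _ _ _ hR).trans (le_of_eq ?_)
    rw [card_initial (rounds_le v s), nsmul_eq_mul]
    push_cast
    ring

/-! ### Choosing a color for a vertex -/

/-- Try the colors of a palette in random order, until one is found such that `v` has no neighbor
in its class. -/
noncomputable def pick (R : ℕ) (v : Fin n) (cls : Fin n → Finset (Fin n)) :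
    ℕ → Finset (Fin n) → Proc n (Fin n)
  | 0, _ => .pure 0
  | m + 1, P => (draw P).bind fun γ => (test v (cls γ) R).bind fun b =>
      if b then pick R v cls m (P.erase γ) else .pure γ

end Proc

/-- The colors of `P` that are not used by a neighbor of `v`. -/
def Input.available (v : Fin n) (cls : Fin n → Finset (Fin n)) (P : Finset (Fin n)) :
    Finset (Fin n) := {γ ∈ P | ∀ i ∈ cls γ, ¬ I.graph.Adj v i}

omit [NeZero n] in
theorem Input.available_erase {v : Fin n} {cls : Fin n → Finset (Fin n)} {P : Finset (Fin n)}
    {γ : Fin n} (h : γ ∉ I.available v cls P) :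
    I.available v cls (P.erase γ) = I.available v cls P := by
  unfold Input.available at *
  rw [filter_erase, erase_eq_of_notMem h]

omit [NeZero n] in
theorem Input.exists_adj_of_notMem_available {v : Fin n} {cls : Fin n → Finset (Fin n)}
    {P : Finset (Fin n)} {γ : Fin n} (hγ : γ ∈ P) (h : γ ∉ I.available v cls P) :
    ∃ i ∈ cls γ, I.graph.Adj v i := by
  by_contra! hc
  exact h (mem_filter.2 ⟨hγ, hc⟩)

namespace Proc

/-- With perfect tests and `a` available colors, an unavailable color is tried only if it precedes
all of them, with probability 1/(a + 1), and an available one is tried with probability 1/a. So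
every color contributes at most its test cost over `a`. The induction conditions on the first color
drawn; erasing an unavailable one keeps `a`. -/
theorem cost_pick_le (R : ℕ) (v : Fin n) (cls : Fin n → Finset (Fin n)) (m : ℕ)
    (P : Finset (Fin n)) (hP : #P = m) (hA : (I.available v cls P).Nonempty) :
    (pick R v cls m P).cost I ≤
      (∑ γ ∈ P, (R * rounds v (cls γ) : ℝ)) / #(I.available v cls P) := by
  induction m generalizing P with
  | zero =>
    rw [pick, cost]
    exact div_nonneg (sum_nonneg fun _ _ => by positivity) (Nat.cast_nonneg _)
  | succ m ih =>
    set A := I.available v cls P with hAdef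
    set w : Fin n → ℝ := fun γ => R * rounds v (cls γ) with hw
    set W := ∑ γ ∈ P, w γ with hW
    have hw0 : ∀ γ, 0 ≤ w γ := fun γ => by positivity
    have hPne : P.Nonempty := card_pos.1 (by omega)
    have hp : (0 : ℝ) < #P := by exact_mod_cast hPne.card_pos
    have ha : (0 : ℝ) < #A := by exact_mod_cast hA.card_pos
    have hAP : A ⊆ P := filter_subset _ _
    rw [pick, cost_bind, cost_draw, expect_draw I hPne, zero_add, div_le_iff₀ hp]
    have hstep : ∀ γ ∈ P, ((test v (cls γ) R).bind fun b =>
        if b then pick R v cls m (P.erase γ) else .pure γ).cost I ≤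
        w γ + (if γ ∈ A then 0 else (W - w γ) / #A) := by
      intro γ hγ
      rw [cost_bind]
      refine add_le_add (cost_test_le I _ _ _) ?_
      split_ifs with hγA
      · rw [expect_test_of_forall_not_adj I _ _ (mem_filter.1 hγA).2]
        simp [cost]
      · have hE := ih (P.erase γ) (by rw [card_erase_of_mem hγ, hP]; rfl)
          (by rwa [I.available_erase hγA])
        rw [I.available_erase hγA, sum_erase_eq_sub hγ] at hE
        refine le_trans (expect_mono I _ (g := fun _ => (W - w γ) / #A) fun b => ?_)
          (expect_const I _ _).le
        cases b
        · simp only [Bool.false_eq_true, if_false, cost]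
          exact (cost_nonneg I _).trans hE
        · simpa using hE
    refine (sum_le_sum hstep).trans ?_
    have hsplit : ∑ γ ∈ P, (if γ ∈ A then 0 else (W - w γ) / #A) =
        ((#P - #A) * W - ∑ γ ∈ P \ A, w γ) / #A := by
      rw [← sum_sdiff hAP]
      have h1 : ∑ γ ∈ P \ A, (if γ ∈ A then 0 else (W - w γ) / #A) =
          ∑ γ ∈ P \ A, (W - w γ) / #A :=
        sum_congr rfl fun γ hγ => if_neg (mem_sdiff.1 hγ).2
      have h2 : ∑ γ ∈ A, (if γ ∈ A then 0 else (W - w γ) / #A) = 0 :=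
        sum_eq_zero fun γ hγ => if_pos hγ
      rw [h1, h2, add_zero, ← sum_div, sum_sub_distrib, sum_const, nsmul_eq_mul,
        card_sdiff_of_subset hAP, Nat.cast_sub (card_le_card hAP)]
    rw [sum_add_distrib, hsplit, ← hW]
    have hWA : W = ∑ γ ∈ P \ A, w γ + ∑ γ ∈ A, w γ := (sum_sdiff hAP).symm
    have hwA : 0 ≤ ∑ γ ∈ P \ A, w γ := sum_nonneg fun γ _ => hw0 γ
    rw [div_mul_eq_mul_div, ← sub_nonneg]
    have : W * #P / #A - (W + ((#P - #A) * W - ∑ γ ∈ P \ A, w γ) / #A) =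
        (∑ γ ∈ P \ A, w γ) / #A := by field_simp; ring
    rw [this]
    positivity

open Classical in
theorem le_expect_pick (R : ℕ) (v : Fin n) (cls : Fin n → Finset (Fin n)) (P₀ : Finset (Fin n))
    (m : ℕ) (P : Finset (Fin n)) (hP : #P = m) (hPP : P ⊆ P₀)
    (hA : (I.available v cls P).Nonempty) :
    1 - m * (3 / 4 : ℝ) ^ R ≤
      (pick R v cls m P).expect I fun γ => if γ ∈ I.available v cls P₀ then 1 else 0 := by
  induction m generalizing P with
  | zero =>
    obtain ⟨γ, hγ⟩ := hA
    rw [card_eq_zero.1 hP] at hγ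
    simp [Input.available] at hγ
  | succ m ih =>
    have hPne : P.Nonempty := card_pos.1 (by omega)
    have hp : (0 : ℝ) < #P := by exact_mod_cast hPne.card_pos
    rw [pick, expect_bind, expect_draw I hPne, le_div_iff₀ hp, mul_comm, ← nsmul_eq_mul]
    refine card_nsmul_le_sum _ _ _ fun γ hγ => ?_
    rw [expect_bind]
    by_cases hγA : γ ∈ I.available v cls P
    · rw [expect_test_of_forall_not_adj I _ _ (mem_filter.1 hγA).2]
      simp only [Bool.false_eq_true, if_false, expect]
      have hγ₀ : γ ∈ I.available v cls P₀ := mem_filter.2 ⟨hPP hγ, (mem_filter.1 hγA).2⟩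
      rw [if_pos hγ₀, sub_le_self_iff]
      positivity
    · have hE := ih (P.erase γ) (by rw [card_erase_of_mem hγ, hP]; rfl)
        ((erase_subset _ _).trans hPP) (by rwa [I.available_erase hγA])
      set x := (pick R v cls m (P.erase γ)).expect I
        fun γ => if γ ∈ I.available v cls P₀ then 1 else 0
      have hx1 : x ≤ 1 := (expect_mono I _ (g := fun _ => 1) fun γ => by
        split_ifs <;> norm_num).trans (expect_const I _ _).le
      have hmiss := expect_test_le I v (cls γ) (I.exists_adj_of_notMem_available hγ hγA) R
      -- A correct answer leaves success probability `x`, and a miss loses at most 1.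
      have key : x - (3 / 4 : ℝ) ^ R ≤ (test v (cls γ) R).expect I fun b =>
          (if b then pick R v cls m (P.erase γ) else .pure γ).expect I
            fun γ => if γ ∈ I.available v cls P₀ then 1 else 0 := by
        have hle := expect_mono I (test v (cls γ) R)
          (f := fun b => x + (-1) * (if b then 0 else 1))
          (g := fun b => (if b then pick R v cls m (P.erase γ) else .pure γ).expect I
            fun γ => if γ ∈ I.available v cls P₀ then 1 else 0) (fun b => by
            cases b
            · simp only [Bool.false_eq_true, if_false, expect]
              split_ifs <;> linarith
            · simp only [if_true, mul_zero, add_zero]; exact le_rfl)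
        rw [expect_add, expect_const, expect_mul] at hle
        linarith
      refine le_trans ?_ key
      push_cast
      linarith

end Proc

/-! ### Coloring all vertices in random order -/

/-- The vertices outside of `U` with the color `γ`. -/
def colorClass (U : Finset (Fin n)) (c : Fin n → Fin n) (γ : Fin n) : Finset (Fin n) :=
  {u | u ∉ U ∧ c u = γ}

/-- The number of neighbors of `v` in `U`. -/
def Input.degreeIn (U : Finset (Fin n)) (v : Fin n) : ℕ := #{u ∈ U | I.graph.Adj v u}

omit [NeZero n] in
theorem Input.degreeIn_le (U : Finset (Fin n)) (v : Fin n) :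
    I.degreeIn U v ≤ I.graph.degree v := by
  rw [← I.graph.card_neighborFinset_eq_degree]
  refine card_le_card fun u hu => ?_
  simpa using (mem_filter.1 hu).2

omit [NeZero n] in
theorem Input.degreeIn_univ (v : Fin n) : I.degreeIn univ v = I.graph.degree v := by
  rw [← I.graph.card_neighborFinset_eq_degree, I.graph.neighborFinset_eq_filter, Input.degreeIn]

omit [NeZero n] in
theorem Input.degreeIn_erase (U : Finset (Fin n)) {u v : Fin n} (hv : v ∈ U) :
    I.degreeIn (U.erase v) u = I.degreeIn U u - if I.graph.Adj u v then 1 else 0 := by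
  unfold Input.degreeIn
  rw [filter_erase]
  split_ifs with h
  · rw [card_erase_of_mem (mem_filter.2 ⟨hv, h⟩)]
  · rw [erase_eq_of_notMem (by simp [h])]; rfl

omit [NeZero n] in
-- Each unavailable color is used by a neighbor outside `U`, and there are deg v − `degreeIn` of
-- these. The coloring need not be proper.
theorem Input.card_add_degreeIn_le (U : Finset (Fin n)) (c : Fin n → Fin n) (P : Finset (Fin n))
    (v : Fin n) :
    #P + I.degreeIn U v ≤ #(I.available v (colorClass U c) P) + I.graph.degree v := by
  have h1 : P \ I.available v (colorClass U c) P ⊆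
      ({u ∈ Uᶜ | I.graph.Adj v u} : Finset (Fin n)).image c := by
    intro γ hγ
    obtain ⟨hγ, hγA⟩ := mem_sdiff.1 hγ
    obtain ⟨i, hi, hvi⟩ := I.exists_adj_of_notMem_available hγ hγA
    simp only [colorClass, mem_filter, mem_univ, true_and] at hi
    exact mem_image.2 ⟨i, mem_filter.2 ⟨mem_compl.2 hi.1, hvi⟩, hi.2⟩
  have h2 := (card_le_card h1).trans card_image_le
  have h3 : I.degreeIn U v + I.degreeIn Uᶜ v = I.graph.degree v := by
    rw [← I.degreeIn_univ, ← union_compl U]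
    unfold Input.degreeIn
    rw [filter_union, card_union_of_disjoint]
    exact disjoint_filter_filter disjoint_compl_right
  have h4 : #(P \ I.available v (colorClass U c) P) = #P - #(I.available v (colorClass U c) P) :=
    card_sdiff_of_subset (filter_subset _ _)
  have h5 : I.degreeIn Uᶜ v = #({u ∈ Uᶜ | I.graph.Adj v u} : Finset (Fin n)) := rfl
  omega

/-- The average of `1, 1/2, …, 1/(r+1)`. -/
noncomputable def harmonicAverage (r : ℕ) : ℝ := (∑ i ∈ range (r + 1), 1 / ((i : ℝ) + 1)) / (r + 1)

theorem harmonicAverage_nonneg (r : ℕ) : 0 ≤ harmonicAverage r := by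
  unfold harmonicAverage; positivity

/-- Among a vertex and its `r` uncolored neighbors, each is equally likely to come first. If the
vertex does, it contributes 1/(r + 1); otherwise `r` drops by one. The truncated `r - 1` at `r = 0`
is multiplied by 0. -/
theorem harmonicAverage_rec (r : ℕ) :
    1 / ((r : ℝ) + 1) + r * harmonicAverage (r - 1) = (r + 1) * harmonicAverage r := by
  have h : ((r : ℝ) + 1) * harmonicAverage r = ∑ i ∈ range (r + 1), 1 / ((i : ℝ) + 1) := by
    unfold harmonicAverage; field_simp
  rw [h, sum_range_succ, add_comm]
  congr 1
  cases r with
  | zero => simp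
  | succ r =>
    simp only [Nat.add_sub_cancel, harmonicAverage]
    push_cast
    field_simp

/-- An upper bound for the expected value of `1 / a`, where `a` is the number of colors that are
available to `v` when it is its turn in a random ordering of `U`. -/
noncomputable def Input.potential (U : Finset (Fin n)) (v : Fin n) : ℝ :=
  (I.graph.degree v + 1) / (I.graph.maxDegree + 1) * harmonicAverage (I.degreeIn U v)

omit [NeZero n] in
theorem Input.potential_nonneg (U : Finset (Fin n)) (v : Fin n) : 0 ≤ I.potential U v :=
  mul_nonneg (by positivity) (harmonicAverage_nonneg _)

omit [NeZero n] in
theorem Input.one_div_card_available_le (U : Finset (Fin n)) (c : Fin n → Fin n)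
    (P : Finset (Fin n)) (hP : #P = I.graph.maxDegree + 1) (v : Fin n) :
    1 / (#(I.available v (colorClass U c) P) : ℝ) ≤
      (I.graph.degree v + 1) / (I.graph.maxDegree + 1) * (1 / (I.degreeIn U v + 1)) := by
  have h1 := I.card_add_degreeIn_le U c P v
  have h2 := I.degreeIn_le U v
  have h3 := I.graph.degree_le_maxDegree v
  rw [hP] at h1
  set a := #(I.available v (colorClass U c) P)
  set r := I.degreeIn U v
  set d := I.graph.degree v
  set D := I.graph.maxDegree
  obtain ⟨s, hs⟩ := Nat.exists_eq_add_of_le h3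
  have ha : 1 + s + r ≤ a := by omega
  have ha' : (1 + s + r : ℝ) ≤ a := by exact_mod_cast ha
  have hrd : (r : ℝ) ≤ d := by exact_mod_cast h2
  have hs' : (D : ℝ) = d + s := by exact_mod_cast hs
  have hs0 : (0 : ℝ) ≤ s := s.cast_nonneg
  have hr0 : (0 : ℝ) ≤ r := r.cast_nonneg
  have hd0 : (0 : ℝ) ≤ d := d.cast_nonneg
  rw [div_mul_div_comm, mul_one, hs', div_le_div_iff₀ (by linarith) (by positivity)]
  -- With s = Δ − d, the claim (d + 1 + s)(r + 1) ≤ (d + 1)(s + r + 1) reduces to s·r ≤ s·d.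
  nlinarith [mul_le_mul_of_nonneg_left ha' (by linarith : (0 : ℝ) ≤ d + 1),
    mul_le_mul_of_nonneg_left hrd hs0]

omit [NeZero n] in
theorem Input.sum_harmonicAverage_erase (U : Finset (Fin n)) {u : Fin n} (hu : u ∈ U) :
    1 / ((I.degreeIn U u : ℝ) + 1) +
      ∑ v ∈ U.erase u, harmonicAverage (I.degreeIn (U.erase v) u) =
      #U * harmonicAverage (I.degreeIn U u) := by
  set r := I.degreeIn U u with hr
  have h1 : ∀ v ∈ U.erase u, harmonicAverage (I.degreeIn (U.erase v) u) =
      harmonicAverage r + if I.graph.Adj u v then harmonicAverage (r - 1) - harmonicAverage r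
        else 0 := by
    intro v hv
    rw [I.degreeIn_erase U (mem_of_mem_erase hv)]
    split_ifs <;> simp [hr]
  have h2 : #{v ∈ U.erase u | I.graph.Adj u v} = r := by
    rw [filter_erase, erase_eq_of_notMem (by simp), hr, Input.degreeIn]
  rw [sum_congr rfl h1, sum_add_distrib, ← sum_filter, sum_const, sum_const, h2, nsmul_eq_mul,
    nsmul_eq_mul, card_erase_of_mem hu, Nat.cast_sub (card_pos.2 ⟨u, hu⟩)]
  have := harmonicAverage_rec r
  push_cast
  linear_combination this

omit [NeZero n] in
-- The potential is the exact solution of the recursion over the first vertex drawn. Exchanging the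
-- sums fixes a vertex `u` and averages over the vertex removed, which is
-- `sum_harmonicAverage_erase`.
theorem Input.sum_potential_erase (U : Finset (Fin n)) :
    ∑ v ∈ U, ((I.graph.degree v + 1) / (I.graph.maxDegree + 1) * (1 / (I.degreeIn U v + 1)) +
      ∑ u ∈ U.erase v, I.potential (U.erase v) u) = #U * ∑ v ∈ U, I.potential U v := by
  have hswap : ∑ v ∈ U, ∑ u ∈ U.erase v, I.potential (U.erase v) u =
      ∑ u ∈ U, ∑ v ∈ U.erase u, I.potential (U.erase v) u := by
    refine sum_comm' fun v u => ?_
    simp only [mem_erase]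
    tauto
  rw [sum_add_distrib, hswap, ← sum_add_distrib, mul_sum]
  refine sum_congr rfl fun u hu => ?_
  unfold Input.potential
  rw [← mul_sum, ← mul_add, I.sum_harmonicAverage_erase U hu]
  ring

namespace Proc

/-- Color the vertices of `U` in random order. -/
noncomputable def colorAll (R : ℕ) (P : Finset (Fin n)) :
    ℕ → Finset (Fin n) → (Fin n → Fin n) → Proc n (Fin n → ℕ)
  | 0, _, c => .pure fun v => c v
  | m + 1, U, c => (draw U).bind fun v => (pick R v (colorClass U c) #P P).bind fun γ =>
      colorAll R P m (U.erase v) (Function.update c v γ)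

omit [NeZero n] in
theorem available_nonempty (U : Finset (Fin n)) (c : Fin n → Fin n)
    (P : Finset (Fin n)) (hP : #P = I.graph.maxDegree + 1) (v : Fin n) :
    (I.available v (colorClass U c) P).Nonempty := by
  have h1 := I.card_add_degreeIn_le U c P v
  have h3 := I.graph.degree_le_maxDegree v
  exact card_pos.1 (by omega)

/-- The partial coloring is arbitrary, so earlier errors need no conditioning and the bound depends
only on which vertices remain. -/
theorem cost_colorAll_le (R : ℕ) (P : Finset (Fin n)) (hP : #P = I.graph.maxDegree + 1)
    (W : ℝ) (hW : ∀ v U c, ∑ γ ∈ P, (R * rounds v (colorClass U c γ) : ℝ) ≤ W)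
    (m : ℕ) (U : Finset (Fin n)) (hU : #U = m) (c : Fin n → Fin n) :
    (colorAll R P m U c).cost I ≤ W * ∑ v ∈ U, I.potential U v := by
  have hW0 : 0 ≤ W := le_trans (sum_nonneg fun _ _ => by positivity) (hW 0 ∅ fun _ => 0)
  induction m generalizing U c with
  | zero =>
    rw [colorAll, cost]
    exact mul_nonneg hW0 (sum_nonneg fun v _ => I.potential_nonneg U v)
  | succ m ih =>
    have hUne : U.Nonempty := card_pos.1 (by omega)
    have hp : (0 : ℝ) < #U := by exact_mod_cast hUne.card_pos
    rw [colorAll, cost_bind, cost_draw, expect_draw I hUne, zero_add, div_le_iff₀ hp, mul_assoc,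
      mul_comm _ (#U : ℝ), ← I.sum_potential_erase U, mul_sum]
    refine sum_le_sum fun v hv => ?_
    rw [cost_bind, mul_add]
    refine add_le_add ?_ ?_
    · refine (cost_pick_le I R v _ _ P rfl (available_nonempty I U c P hP v)).trans ?_
      rw [div_eq_mul_one_div]
      exact mul_le_mul (hW v U c) (I.one_div_card_available_le U c P hP v) (by positivity) hW0
    · refine (expect_mono I _ fun γ => ih (U.erase v) ?_ _).trans (expect_const I _ _).le
      rw [card_erase_of_mem hv, hU]; rfl

open Classical in
theorem le_expect_colorAll (R : ℕ) (P : Finset (Fin n))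
    (hP : #P = I.graph.maxDegree + 1) (hPlt : ∀ γ ∈ P, (γ : ℕ) < I.graph.maxDegree + 1)
    (m : ℕ) (U : Finset (Fin n)) (hU : #U = m) (c : Fin n → Fin n)
    (hc : ∀ u ∉ U, c u ∈ P) (hcc : ∀ u ∉ U, ∀ v ∉ U, I.graph.Adj u v → c u ≠ c v) :
    1 - m * (n * (3 / 4 : ℝ) ^ R) ≤
      (colorAll R P m U c).expect I fun c => if c ∈ I.properColorings then 1 else 0 := by
  induction m generalizing U c with
  | zero =>
    rw [card_eq_zero] at hU
    subst hU
    have : (fun v => (c v : ℕ)) ∈ I.properColorings := by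
      refine ⟨SimpleGraph.Coloring.mk (fun v => ⟨c v, hPlt _ (hc v (by simp))⟩) ?_, fun v => rfl⟩
      intro u v huv h
      exact hcc u (by simp) v (by simp) huv (Fin.ext (by simpa using h))
    simp [colorAll, expect, this]
  | succ m ih =>
    have hUne : U.Nonempty := card_pos.1 (by omega)
    have hp : (0 : ℝ) < #U := by exact_mod_cast hUne.card_pos
    have hPn : (#P : ℝ) ≤ n := by exact_mod_cast (by simpa using card_le_univ P)
    rw [colorAll, expect_bind, expect_draw I hUne, le_div_iff₀ hp, mul_comm, ← nsmul_eq_mul]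
    refine card_nsmul_le_sum _ _ _ fun v hv => ?_
    rw [expect_bind]
    have hpick := le_expect_pick I R v (colorClass U c) P _ P rfl subset_rfl
      (available_nonempty I U c P hP v)
    have hle := expect_mono I (pick R v (colorClass U c) #P P)
      (f := fun γ => (if γ ∈ I.available v (colorClass U c) P then 1 else 0) +
        -(m * (n * (3 / 4 : ℝ) ^ R)))
      (g := fun γ => (colorAll R P m (U.erase v) (Function.update c v γ)).expect I
        fun c => if c ∈ I.properColorings then 1 else 0) (fun γ => by
        split_ifs with hγ
        · rw [← sub_eq_add_neg]
          obtain ⟨hγP, hγ⟩ := mem_filter.1 hγ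
          have hfree : ∀ u, u ≠ v → u ∉ U.erase v → I.graph.Adj v u → c u ≠ γ := by
            intro u huv hu hadj hcu
            refine hγ u ?_ hadj
            simp only [colorClass, mem_filter, mem_univ, true_and]
            exact ⟨fun h => hu (mem_erase.2 ⟨huv, h⟩), hcu⟩
          refine ih (U.erase v) (by rw [card_erase_of_mem hv, hU]; rfl) _ ?_ ?_
          · intro u hu
            by_cases huv : u = v
            · subst huv; simpa using hγP
            · rw [Function.update_of_ne huv]
              exact hc u fun h => hu (mem_erase.2 ⟨huv, h⟩)
          · intro u hu w hw huw
            by_cases huv : u = v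
            · subst huv
              have hwu : w ≠ u := huw.ne'
              rw [Function.update_self, Function.update_of_ne hwu]
              exact (hfree w hwu hw huw).symm
            · by_cases hwv : w = v
              · subst hwv
                rw [Function.update_self, Function.update_of_ne huv]
                exact hfree u huv hu huw.symm
              · rw [Function.update_of_ne huv, Function.update_of_ne hwv]
                exact hcc u (fun h => hu (mem_erase.2 ⟨huv, h⟩)) w
                  (fun h => hw (mem_erase.2 ⟨hwv, h⟩)) huw
        -- After an unavailable color nothing is claimed beyond nonnegativity of the success
        -- probability.
        · refine le_trans ?_ (le_of_eq (expect_const I _ 0).symm |>.trans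
            (expect_mono I _ fun c => ?_))
          · rw [zero_add, neg_nonpos]; positivity
          · split_ifs <;> norm_num)
    rw [expect_add, expect_const] at hle
    have h34 : (0 : ℝ) ≤ (3 / 4 : ℝ) ^ R := by positivity
    have := mul_le_mul_of_nonneg_right hPn h34
    refine le_trans ?_ hle
    push_cast
    linarith

omit [NeZero n] in
-- Color classes are disjoint, so Cauchy–Schwarz bounds the sum of their square roots by √(#P · n).
-- The extra 1 per color adds #P, which is at most the same since #P ≤ n.
theorem sum_rounds_le (P : Finset (Fin n)) (v : Fin n) (U : Finset (Fin n)) (c : Fin n → Fin n) :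
    ∑ γ ∈ P, (rounds v (colorClass U c γ) : ℝ) ≤ 2 * √(#P * n) := by
  have hPn : (#P : ℝ) ≤ n := by exact_mod_cast (by simpa using card_le_univ P)
  have h1 : ∀ γ ∈ P, (rounds v (colorClass U c γ) : ℝ) ≤ √(#(colorClass U c γ) : ℝ) + 1 := by
    intro γ _
    rw [rounds]
    push_cast
    gcongr
    refine (Real.nat_sqrt_le_real_sqrt).trans (Real.sqrt_le_sqrt ?_)
    have := card_insert_le v (colorClass U c γ)
    exact_mod_cast (by omega)
  have h2 : ∑ γ ∈ P, (#(colorClass U c γ) : ℝ) ≤ n := by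
    have h := card_eq_sum_card_fiberwise (s := Uᶜ) (t := univ) (f := c) fun _ _ => by simp
    have h' : ∑ γ ∈ P, #(colorClass U c γ) ≤ ∑ γ, #{a ∈ Uᶜ | c a = γ} := by
      refine (sum_le_sum fun γ _ => card_le_card fun u hu => ?_).trans
        (sum_le_sum_of_subset (subset_univ P))
      simpa [colorClass] using hu
    rw [← h] at h'
    have h3 : #Uᶜ ≤ n := by simpa using card_le_univ Uᶜ
    exact_mod_cast h'.trans h3
  have h3 : ∑ γ ∈ P, √(#(colorClass U c γ) : ℝ) ≤ √(#P * n) := by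
    refine Real.le_sqrt_of_sq_le ((sq_sum_le_card_mul_sum_sq).trans ?_)
    gcongr
    refine le_trans (le_of_eq (sum_congr rfl fun γ _ => ?_)) h2
    exact Real.sq_sqrt (Nat.cast_nonneg _)
  have h4 : (#P : ℝ) ≤ √(#P * n) := by
    refine Real.le_sqrt_of_sq_le ?_
    rw [sq]
    gcongr
  refine (sum_le_sum h1).trans ?_
  rw [sum_add_distrib, sum_const, nsmul_eq_mul, mul_one]
  linarith

end Proc

end Greedy

/-! ### Reading sparse graphs completely, the combined algorithm, and its parameters -/

section Main

/-- Any set of vertices has a greedy coloring with one color more than the maximum degree. -/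
theorem exists_greedy_coloring {n : ℕ} (I : Input n) (U : Finset (Fin n)) :
    ∃ c : Fin n → ℕ, (∀ v, c v ≤ I.graph.maxDegree) ∧
      ∀ u ∈ U, ∀ v ∈ U, I.graph.Adj u v → c u ≠ c v := by
  induction U using Finset.induction_on with
  | empty => exact ⟨fun _ => 0, fun _ => Nat.zero_le _, by simp⟩
  | insert a U ha ih =>
    obtain ⟨c, hc, hcc⟩ := ih
    have hcard : #((I.graph.neighborFinset a).image c) < #(range (I.graph.maxDegree + 1)) := by
      rw [card_range]
      refine lt_of_le_of_lt card_image_le ?_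
      rw [I.graph.card_neighborFinset_eq_degree]
      exact Nat.lt_succ_of_le (I.graph.degree_le_maxDegree a)
    obtain ⟨γ, hγ, hγ'⟩ := exists_mem_notMem_of_card_lt_card hcard
    have hfree : ∀ v, I.graph.Adj a v → c v ≠ γ := fun v hv h =>
      hγ' (mem_image.2 ⟨v, by simpa using hv, h⟩)
    refine ⟨Function.update c a γ, fun v => ?_, fun u hu v hv huv => ?_⟩
    · by_cases h : v = a
      · subst h; simpa [Nat.lt_succ_iff] using hγ
      · simpa [h] using hc v
    · by_cases h : u = a
      · subst h
        rw [Function.update_self, Function.update_of_ne huv.ne']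
        exact (hfree v huv).symm
      · by_cases h' : v = a
        · subst h'
          rw [Function.update_self, Function.update_of_ne h]
          exact hfree u huv.symm
        · rw [Function.update_of_ne h, Function.update_of_ne h']
          exact hcc u (mem_of_mem_insert_of_ne hu h) v (mem_of_mem_insert_of_ne hv h') huv

variable {n : ℕ}

theorem Input.mem_properColorings (I : Input n) {c : Fin n → ℕ}
    (hc : ∀ v, c v ≤ I.graph.maxDegree) (hcc : ∀ u v, I.graph.Adj u v → c u ≠ c v) :
    c ∈ I.properColorings :=
  ⟨SimpleGraph.Coloring.mk (fun v => ⟨c v, Nat.lt_succ_of_le (hc v)⟩)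
    fun {u v} huv h => hcc u v huv (by simpa using h), fun _ => rfl⟩

theorem Input.toNat_neighborAnswer (I : Input n) {v j : Fin n}
    (h : (j : ℕ) < I.graph.degree v) :
    (I.neighborAnswer v j).toNat = ((I.nbr v ⟨j, h⟩ : Fin n) : ℕ) + 1 := by
  rw [Input.neighborAnswer, dif_pos h, BitVec.toNat_ofNat, Nat.mod_eq_of_lt]
  exact lt_of_le_of_lt (I.nbr v ⟨j, h⟩ : Fin n).2 (Nat.lt_size_self n)

/-- The answers to the neighborhood queries with an index below `D`. -/
def Input.answers (I : Input n) (D : ℕ) (p : Fin n × Fin n) : ℕ :=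
  if (p.2 : ℕ) < D then (I.neighborAnswer p.1 p.2).toNat else 0

theorem Input.adj_iff_answers (I : Input n) (u v : Fin n) :
    I.graph.Adj u v ↔ ∃ j, I.answers I.graph.maxDegree (u, j) = v + 1 := by
  constructor
  · intro h
    obtain ⟨j, hj⟩ := (I.nbr u).surjective ⟨v, h⟩
    have hjn : (j : ℕ) < n := by
      have := I.graph.degree_lt_card_verts u
      simp only [Fintype.card_fin] at this
      exact j.2.trans this
    refine ⟨⟨j, hjn⟩, ?_⟩
    rw [Input.answers, if_pos (j.2.trans_le (I.graph.degree_le_maxDegree u)),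
      I.toNat_neighborAnswer j.2]
    simp [hj]
  · rintro ⟨j, hj⟩
    by_cases h : (j : ℕ) < I.graph.degree u
    · rw [Input.answers, if_pos (h.trans_le (I.graph.degree_le_maxDegree u)),
        I.toNat_neighborAnswer h] at hj
      have h2 := (I.nbr u ⟨j, h⟩).2
      rwa [Fin.ext (Nat.succ_injective hj)] at h2
    · simp [Input.answers, Input.neighborAnswer, h] at hj

open Classical in
/-- A coloring with the colors `0, …, D` of the graph that is described by the answers `f`. -/
noncomputable def colorAnswers (D : ℕ) (f : Fin n × Fin n → ℕ) : Fin n → ℕ :=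
  if h : ∃ c : Fin n → ℕ, (∀ v, c v ≤ D) ∧ ∀ u v : Fin n, (∃ j, f (u, j) = v + 1) → c u ≠ c v
  then h.choose else 0

theorem colorAnswers_mem (I : Input n) :
    colorAnswers I.graph.maxDegree (I.answers I.graph.maxDegree) ∈ I.properColorings := by
  have h : ∃ c : Fin n → ℕ, (∀ v, c v ≤ I.graph.maxDegree) ∧ ∀ u v : Fin n,
      (∃ j, I.answers I.graph.maxDegree (u, j) = v + 1) → c u ≠ c v := by
    obtain ⟨c, hc, hcc⟩ := exists_greedy_coloring I univ
    exact ⟨c, hc, fun u v h => hcc u (mem_univ _) v (mem_univ _) ((I.adj_iff_answers u v).2 h)⟩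
  rw [colorAnswers, dif_pos h]
  exact I.mem_properColorings h.choose_spec.1 fun u v huv =>
    h.choose_spec.2 u v ((I.adj_iff_answers u v).1 huv)

/-- The pairs of a vertex and an index below `D`. -/
def queryPairs (n D : ℕ) : Finset (Fin n × Fin n) := univ ×ˢ Proc.initial n D

namespace Proc

variable [NeZero n]

/-- The coloring algorithm, with `R` repetitions of each search. After the degrees are known,
graphs of small maximum degree are read completely, and the others are colored by random greedy
choices. -/
noncomputable def main (n R : ℕ) [NeZero n] : Proc n (Fin n → ℕ) :=
  (collect degree univ.toList fun _ => 0).bind fun d =>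
    if univ.sup d ^ 3 ≤ n then
      (collect (fun p : Fin n × Fin n => neighbor p.1 p.2) (queryPairs n (univ.sup d)).toList
        fun _ => 0).bind fun f => .pure (colorAnswers (univ.sup d) f)
    else colorAll R (initial n (univ.sup d + 1)) n univ fun _ => 0

omit [NeZero n] in
theorem sup_degree (I : Input n) : (univ.sup fun v => I.graph.degree v) = I.graph.maxDegree := by
  refine le_antisymm (Finset.sup_le fun v _ => I.graph.degree_le_maxDegree v) ?_
  exact I.graph.maxDegree_le_of_forall_degree_le _ fun v =>
    le_sup (f := fun v => I.graph.degree v) (mem_univ v)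

theorem maxDegree_lt (I : Input n) : I.graph.maxDegree < n := by
  simpa using I.graph.maxDegree_lt_card_verts

theorem expect_degrees (I : Input n) (f : (Fin n → ℕ) → ℝ) :
    (collect degree univ.toList fun _ => 0).expect I f = f fun v => I.graph.degree v := by
  rw [expect_collect I _ (fun v => I.graph.degree v) (expect_degree I)]
  simp

theorem expect_neighbors (I : Input n) (D : ℕ) (f : (Fin n × Fin n → ℕ) → ℝ) :
    (collect (fun p : Fin n × Fin n => neighbor p.1 p.2) (queryPairs n D).toList
      fun _ => 0).expect I f = f (I.answers D) := by
  rw [expect_collect I _ (fun p => (I.neighborAnswer p.1 p.2).toNat)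
    fun p => expect_neighbor I p.1 p.2]
  congr 1
  ext p
  simp [queryPairs, initial, Input.answers]

theorem cost_neighbors (I : Input n) {D : ℕ} (hD : D ≤ n) :
    (collect (fun p : Fin n × Fin n => neighbor p.1 p.2) (queryPairs n D).toList
      fun _ => 0).cost I = n * D := by
  rw [cost_collect I (fun p : Fin n × Fin n => neighbor p.1 p.2)
    (fun p => (I.neighborAnswer p.1 p.2).toNat)
    (fun p => expect_neighbor I p.1 p.2) (fun p => cost_neighbor I p.1 p.2), length_toList,
    queryPairs, card_product, card_initial hD, card_univ, Fintype.card_fin, Nat.cast_mul]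

open Classical in
theorem le_expect_main (I : Input n) (R : ℕ) :
    1 - (n : ℝ) ^ 2 * (3 / 4) ^ R ≤
      (main n R).expect I fun c => if c ∈ I.properColorings then 1 else 0 := by
  rw [main, expect_bind, expect_degrees]
  have h34 : (0 : ℝ) ≤ (n : ℝ) ^ 2 * (3 / 4) ^ R := by positivity
  have hD := maxDegree_lt I
  split_ifs with h
  · rw [expect_bind, expect_neighbors, sup_degree, expect, if_pos (colorAnswers_mem I)]
    linarith
  · rw [sup_degree]
    refine le_trans (le_of_eq ?_) (le_expect_colorAll I R _ (card_initial hD)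
      (fun γ hγ => (mem_filter.1 hγ).2) n univ (by simp) _ (by simp) (by simp))
    ring

omit [NeZero n] in
theorem sum_potential_univ_le (I : Input n) :
    ∑ v, I.potential univ v ≤ n * (1 + Real.log n) / (I.graph.maxDegree + 1) := by
  have h : ∀ v ∈ univ, I.potential univ v ≤ (1 + Real.log n) / (I.graph.maxDegree + 1) := by
    intro v _
    rw [Input.potential, I.degreeIn_univ, harmonicAverage]
    have hd : I.graph.degree v + 1 ≤ n := by
      simpa using I.graph.degree_lt_card_verts v
    have h1 : ∑ i ∈ range (I.graph.degree v + 1), 1 / ((i : ℝ) + 1) ≤ 1 + Real.log n := by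
      refine le_trans ?_ (harmonic_le_one_add_log n)
      rw [harmonic]
      push_cast
      simp only [one_div]
      exact sum_le_sum_of_subset_of_nonneg (range_subset_range.2 hd) fun _ _ _ => by positivity
    -- The factor d + 1 cancels the denominator of the harmonic average, so low-degree vertices cost
    -- no more than the others.
    rw [div_mul_div_comm, mul_comm ((I.graph.maxDegree : ℝ) + 1),
      mul_div_mul_left _ _ (by positivity)]
    gcongr
  refine (sum_le_card_nsmul _ _ _ h).trans (le_of_eq ?_)
  rw [card_univ, Fintype.card_fin, nsmul_eq_mul, mul_div_assoc]

theorem cost_main_le (I : Input n) {R : ℕ} (hR : 1 ≤ R) :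
    (main n R).cost I ≤ 3 * R * (n : ℝ) ^ (4 / 3 : ℝ) * (1 + Real.log n) := by
  have hn1 : (1 : ℝ) ≤ n := by exact_mod_cast NeZero.one_le
  have hn0 : (0 : ℝ) < n := by linarith
  have hlog : 0 ≤ Real.log n := Real.log_nonneg hn1
  have hR' : (1 : ℝ) ≤ R := by exact_mod_cast hR
  have hD := maxDegree_lt I
  set D := I.graph.maxDegree with hDdef
  set q : ℝ := (n : ℝ) ^ (1 / 3 : ℝ) with hq
  have hq0 : 0 < q := Real.rpow_pos_of_pos hn0 _
  have hq1 : 1 ≤ q := Real.one_le_rpow hn1 (by norm_num)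
  have hq3 : q ^ 3 = n := by
    rw [hq, ← Real.rpow_natCast, ← Real.rpow_mul hn0.le]; norm_num
  have hpow : (n : ℝ) ^ (4 / 3 : ℝ) = n * q := by
    rw [hq, ← Real.rpow_one_add' hn0.le (by norm_num)]; norm_num
  have hdeg : (n : ℝ) ≤ n * q := le_mul_of_one_le_right hn0.le hq1
  rw [main, cost_bind, cost_collect I _ (fun v => I.graph.degree v) (expect_degree I)
    (cost_degree I), expect_degrees,
    length_toList, card_univ, Fintype.card_fin, hpow, sup_degree]
  -- This absorbs the degree queries, one unit of the constant 3. The other two pay for reading the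
  -- graph or for the factor 2 in `sum_rounds_le`.
  have hbig : n * q ≤ R * (n * q) * (1 + Real.log n) := by
    have h0 : 0 ≤ n * q := by positivity
    have : n * q ≤ R * (n * q) := le_mul_of_one_le_left h0 hR'
    exact this.trans (le_mul_of_one_le_right (by positivity) (by linarith))
  split_ifs with h
  · rw [cost_bind, expect_neighbors, cost_neighbors I hD.le, cost]
    have hDq : (D : ℝ) ≤ q := by
      refine le_of_pow_le_pow_left₀ three_ne_zero hq0.le ?_
      rw [hq3]; exact_mod_cast h
    have : (n : ℝ) * D ≤ n * q := by gcongr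
    linarith
  · have hDq : q ≤ D + 1 := by
      refine le_of_pow_le_pow_left₀ three_ne_zero (by positivity) ?_
      rw [hq3]
      have h1 : (n : ℝ) ≤ (D : ℝ) ^ 3 := by exact_mod_cast (not_le.1 h).le
      exact h1.trans (by gcongr; linarith)
    have hW : ∀ v U c, ∑ γ ∈ initial n (D + 1), (R * rounds v (colorClass U c γ) : ℝ) ≤
        R * (2 * √((D + 1) * n)) := by
      intro v U c
      rw [← mul_sum]
      have := sum_rounds_le (initial n (D + 1)) v U c
      rw [card_initial hD] at this
      push_cast at this
      gcongr
    refine (add_le_add_right (cost_colorAll_le I R _ (card_initial hD) _ hW n univ (by simp) _)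
      _).trans ?_
    -- The threshold enters through n = q³ ≤ q²(D + 1). The factor D + 1 then cancels against the
    -- potential.
    have hsqrt : √((D + 1) * n) ≤ q * (D + 1) := by
      refine Real.sqrt_le_iff.2 ⟨by positivity, ?_⟩
      have h1 : (n : ℝ) ≤ q ^ 2 * (D + 1) := by
        rw [← hq3, pow_succ]; gcongr
      calc ((D : ℝ) + 1) * n ≤ (D + 1) * (q ^ 2 * (D + 1)) := by gcongr
        _ = _ := by ring
    have hpot := sum_potential_univ_le I
    have hpot0 : 0 ≤ ∑ v, I.potential univ v := sum_nonneg fun v _ => I.potential_nonneg _ v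
    have : R * (2 * √((D + 1) * n)) * ∑ v, I.potential univ v ≤
        R * (2 * (q * (D + 1))) * (n * (1 + Real.log n) / (D + 1)) := by gcongr
    have h2 : R * (2 * (q * (D + 1))) * (n * (1 + Real.log n) / (D + 1)) =
        2 * (R * (n * q) * (1 + Real.log n)) := by
      field_simp
    rw [h2] at this
    linarith

end Proc

/-- A number of repetitions that makes every search fail with small probability. -/
noncomputable def repetitions (k n : ℕ) : ℕ := ⌈4 * (k + 2) * Real.log (n + 1)⌉₊

theorem repetitions_spec (k n : ℕ) :
    (n : ℝ) ^ 2 * (3 / 4) ^ repetitions k n ≤ 1 / ((n : ℝ) + 1) ^ k := by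
  have hn : (0 : ℝ) < n + 1 := by positivity
  have h1 : (3 / 4 : ℝ) ^ repetitions k n ≤ 1 / ((n : ℝ) + 1) ^ (k + 2) := by
    -- This explains the 4 in `repetitions`; the 2 in `k + 2` pays for the n² tests.
    have h34 : (3 / 4 : ℝ) ≤ Real.exp (-(1 / 4)) := by
      have := Real.add_one_le_exp (-(1 / 4) : ℝ)
      linarith
    calc (3 / 4 : ℝ) ^ repetitions k n ≤ Real.exp (-(1 / 4)) ^ repetitions k n := by gcongr
      _ = Real.exp (-(repetitions k n / 4)) := by rw [← Real.exp_nat_mul]; ring_nf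
      _ ≤ Real.exp (-((k + 2 : ℕ) * Real.log (n + 1))) := by
        apply Real.exp_le_exp.2
        have := Nat.le_ceil (4 * (k + 2) * Real.log ((n : ℝ) + 1))
        unfold repetitions
        push_cast
        linarith
      _ = 1 / ((n : ℝ) + 1) ^ (k + 2) := by
        rw [Real.exp_neg, Real.exp_nat_mul, Real.exp_log hn, one_div]
  calc (n : ℝ) ^ 2 * (3 / 4) ^ repetitions k n
      ≤ (n + 1) ^ 2 * (1 / ((n : ℝ) + 1) ^ (k + 2)) := by gcongr; linarith
    _ = 1 / ((n : ℝ) + 1) ^ k := by rw [pow_add]; field_simp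

end Main

end QuantumColoring

theorem mainTheorem5 :
    ∃ b : ℕ, ∀ k : ℕ, ∃ C : ℝ, 0 < C ∧ ∀ n : ℕ, 1 ≤ n →
      ∃ A : QuantumColoring.Algorithm n, ∀ I : QuantumColoring.Input n,
        1 - 1 / ((n : ℝ) + 1) ^ k ≤ A.prob I I.properColorings ∧
        A.expectedQueries I ≤
          C * (n : ℝ) ^ (4 / 3 : ℝ) * Real.log ((n : ℝ) + 1) ^ b := by
  -- One logarithm comes from the repetitions and one from the harmonic sum. Since log(n + 1) ≥ 1/2,
  -- rounding up the repetitions costs at most 2 log(n + 1), and 1 + log n ≤ 3 log(n + 1) gives 9 =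
  -- 3 · 3.
  refine ⟨2, fun k => ⟨9 * (4 * (k + 2) + 2), by positivity, fun n hn => ?_⟩⟩
  have : NeZero n := ⟨by omega⟩
  have hn1 : (1 : ℝ) ≤ n := by exact_mod_cast hn
  set L := Real.log ((n : ℝ) + 1) with hL
  have hL2 : 1 / 2 ≤ L := by
    have h1 := Real.log_two_gt_d9
    have h2 : Real.log 2 ≤ L := Real.log_le_log (by norm_num) (by linarith)
    linarith
  have hlog : 1 + Real.log n ≤ 3 * L := by
    have : Real.log n ≤ L := Real.log_le_log (by linarith) (by linarith)
    linarith
  have hlog0 : 0 ≤ Real.log n := Real.log_nonneg hn1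
  have hR : 1 ≤ QuantumColoring.repetitions k n := Nat.ceil_pos.2 (by positivity)
  have hR2 : (QuantumColoring.repetitions k n : ℝ) ≤ (4 * (k + 2) + 2) * L := by
    have := (Nat.ceil_lt_add_one (a := 4 * (k + 2) * Real.log ((n : ℝ) + 1)) (by positivity)).le
    unfold QuantumColoring.repetitions
    linarith
  refine ⟨⟨n, (0, 0, 0, 0), (QuantumColoring.Proc.main n
      (QuantumColoring.repetitions k n)).compile (0, 0, 0, 0)⟩,
    fun I => ⟨?_, ?_⟩⟩
  · refine le_trans ?_ (QuantumColoring.Proc.prob_compile I _ _ _).ge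
    have := QuantumColoring.Proc.le_expect_main I (QuantumColoring.repetitions k n)
    have := QuantumColoring.repetitions_spec k n
    linarith
  · refine (QuantumColoring.Proc.expectedQueries_compile I _ _).le.trans
      ((QuantumColoring.Proc.cost_main_le I hR).trans ?_)
    calc 3 * (QuantumColoring.repetitions k n : ℝ) * (n : ℝ) ^ (4 / 3 : ℝ) * (1 + Real.log n)
        ≤ 3 * ((4 * (k + 2) + 2) * L) * (n : ℝ) ^ (4 / 3 : ℝ) * (3 * L) := by gcongr
      _ = _ := by ring
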